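/- Let $B\subset\mathbb{C}$ be an open disk with coordinate $t$. Let $(\mathbb{V}_{\mathbb{Z}},E,Q)$ be a polarized variation of Hodge structures of weight one and rank $2g$ on $B$: $\mathbb{V}_{\mathbb{Z}}=\mathbb{Z}^{2g}$ (every local system on a disk is constant), $Q$ is a unimodular antisymmetric integral bilinear form on $\mathbb{V}_{\mathbb{Z}}$, and $E\subseteq\mathcal{H}:=\mathbb{V}_{\mathbb{Z}}\otimes\mathcal{O}_B$ is a holomorphic subbundle of rank $g$ which is isotropic for $Q_{\mathbb{C}}$ and on which the Hodge form $h(u,v)=iQ_{\mathbb{C}}(u,\overline v)$ is positive definite. Then $\mathcal{H}=E\oplus\overline{E}$ as smooth bundles, and $v\mapsto h(\cdot,\overline v)|_E=iQ_{\mathbb{C}}(\cdot,v)|_E$ induces $\mathcal{H}/E\cong E^\vee$. Let $\iota_1\colon E\to\mathcal{H}$ be the inclusion, $\pi_1\colon\mathcal{H}\to E$ the projection along $\overline E$, $\pi_2\colon\mathcal{H}\to E^\vee$ the quotient map, and $\iota_2\colon E^\vee\to\mathcal{H}$ its smooth splitting with image $\overline E$. Let $\nabla$ be the Gauss--Manin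 connection on $\mathcal{H}$ (the de Rham differential in a flat frame), $\theta=\pi_2\nabla\iota_1$ the Higgs field, $\nabla^E=\pi_1\nabla\iota_1$, $\nabla^{E^\vee}=\pi_2\nabla\iota_2$, and for a smooth bundle map $\eta\colon E\to E^\vee$ let $\nabla^H_t\eta$ be given by $(\nabla^H_t\eta)(\alpha)=\nabla^{E^\vee}_t(\eta(\alpha))-\eta(\nabla^E_t\alpha)$ for all smooth local sections $\alpha$ of $E$, where the subscript $t$ denotes the derivative in the direction $\partial/\partial t$. Put $\eta^{(1)}=\iota_{\partial/\partial t}\theta$ and $\eta^{(k)}=(\nabla^H_t)^{k-1}\eta^{(1)}$ for $k\ge 2$. Let $\mathbb{U}$ be the sheaf of holomorphic sections $\sigma$ of $E$ with $\nabla\sigma=0$, let $\mathcal{U}=\mathbb{U}\otimes_{\mathbb{C}}\mathcal{O}_B\subseteq E$ (the flat unitary subbundle), with fibre $\mathcal{U}_b\subseteq E_b$ the space of values at $b$ of sections of $\mathcal{U}$ near $b$, and let $\mathcal{K}^{(r)}\subseteq E$ be the sheaf of holomorphic sections $\alpha$ of $E$ with $\eta^{(1)}(\alpha)=\dots=\eta^{(r)}(\alpha)=0$.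 Then all $\eta^{(k)}$, $k\ge1$, are well-defined smooth symmetric morphisms $E\to E^\vee$, and: (1) for every open $W\subseteq B$, a holomorphic section $\alpha$ of $E$ over $W$ is a section of $\mathcal{U}$ if and only if $\eta^{(1)}(\alpha)=\dots=\eta^{(g)}(\alpha)=0$; that is, $\mathcal{U}=\mathcal{K}^{(g)}$; (2) $\mathcal{U}_b\subseteq\bigcap_{k=1}^g\ker\eta^{(k)}_b$ for every $b\in B$, with equality for all $b$ in some dense Zariski-open subset of $B$ (the complement in $B$ of a closed analytic subset). -/

import Mathlib

open scoped ContDiff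

noncomputable section

/-- The fibre `V_ℂ = V_ℤ ⊗ ℂ` of the constant local system `V_ℤ = ℤ^{2g}`. -/
abbrev HFibre (g : ℕ) : Type := Fin (2 * g) → ℂ

/-- The `ℂ`-bilinear extension `Q_ℂ(u, v) = ᵗu Q v` of the integral form with Gram matrix `Q`. -/
def complexForm {g : ℕ} (Q : Matrix (Fin (2 * g)) (Fin (2 * g)) ℤ) :
    LinearMap.BilinForm ℂ (HFibre g) :=
  Matrix.toBilin' (Q.map (fun n : ℤ => (n : ℂ)))

/-- A polarized variation of Hodge structures of weight one and rank `2g` over a set `B ⊆ ℂ`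
(later an open disk), written in a flat integral frame. Only the values of `E` on `B` matter. -/
structure PVHS (g : ℕ) (B : Set ℂ) where
  /-- Gram matrix of the polarization on `V_ℤ = ℤ^{2g}`. -/
  Q : Matrix (Fin (2 * g)) (Fin (2 * g)) ℤ
  antisymm : Q.transpose = -Q
  unimodular : IsUnit Q.det
  /-- The fibres `E_b ⊆ V_ℂ` of the Hodge bundle `E = E^{1,0}`. -/
  E : ℂ → Submodule ℂ (HFibre g)
  /-- `E` is a holomorphic subbundle of rank `g` of `B × V_ℂ`: it has local holomorphic frames. -/
  local_frame : ∀ b ∈ B, ∃ W : Set ℂ, IsOpen W ∧ b ∈ W ∧ W ⊆ B ∧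
    ∃ e : Fin g → ℂ → HFibre g, (∀ i, DifferentiableOn ℂ (e i) W) ∧
      ∀ z ∈ W, LinearIndependent ℂ (fun i => e i z) ∧
        Submodule.span ℂ (Set.range fun i => e i z) = E z
  /-- First Riemann bilinear relation (`E` is orthogonal to its conjugate for `h`). -/
  isotropic : ∀ b ∈ B, ∀ u ∈ E b, ∀ v ∈ E b, complexForm Q u v = 0
  /-- The Hodge metric `h(u, v) = i Q_ℂ(u, v̄)` is positive definite on `E`
  (the number `h(u, u)` is automatically real). -/
  pos : ∀ b ∈ B, ∀ u ∈ E b, u ≠ 0 → 0 < (Complex.I * complexForm Q u (star u)).re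

/-- Contraction of an `F`-valued (complex) `1`-form at a point with
`∂/∂t = (∂/∂x - i ∂/∂y) / 2`, where `t = x + i y`. -/
def contrDt {F : Type*} [AddCommGroup F] [Module ℂ F] [Module ℝ F] (φ : ℂ →ₗ[ℝ] F) : F :=
  (1 / 2 : ℂ) • (φ 1 - Complex.I • φ Complex.I)

/-- The derivative `∂f/∂t` of a smooth function with values in a complex normed space. -/
def derivDt {F : Type*} [NormedAddCommGroup F] [NormedSpace ℂ F] (f : ℂ → F) (b : ℂ) : F :=
  contrDt (fderiv ℝ f b : ℂ →ₗ[ℝ] F)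

/-- The Gauss-Manin connection on sections of `H = V_ℤ ⊗ O_B = B × V_ℂ`: the de Rham differential
in the flat frame. -/
def gaussManin {g : ℕ} (s : ℂ → HFibre g) (b : ℂ) : ℂ →ₗ[ℝ] HFibre g :=
  (fderiv ℝ s b : ℂ →ₗ[ℝ] HFibre g)

/-- The Gauss-Manin derivative `∇_t` in the direction of `∂/∂t`. -/
def gaussManinDt {g : ℕ} (s : ℂ → HFibre g) (b : ℂ) : HFibre g :=
  contrDt (gaussManin s b)

namespace PVHS

variable {g : ℕ} {B : Set ℂ} (D : PVHS g B)

/-- The fibre at `b` of the complex conjugate bundle of `E`. -/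
def Ebar (b : ℂ) : Submodule ℂ (HFibre g) :=
  (D.E b).comap (starLinearEquiv ℂ : HFibre g ≃ₗ⋆[ℂ] HFibre g).toLinearMap

/-- The fibre at `b` of the dual bundle `E^∨`. -/
abbrev Edual (b : ℂ) : Type := Module.Dual ℂ (D.E b)

/-- The inclusion `ι₁ : E → H`. -/
abbrev iota1 (b : ℂ) : D.E b →ₗ[ℂ] HFibre g := (D.E b).subtype

open Classical in
/-- The projection `π₁ : H → E` along the conjugate of `E`
(for `b ∈ B` the condition holds, see `isCompl`). -/
def pi1 (b : ℂ) : HFibre g →ₗ[ℂ] D.E b :=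
  if h : IsCompl (D.E b) (D.Ebar b) then (D.E b).projectionOnto (D.Ebar b) h else 0

/-- The projection `π₂ : H → H / E ≅ E^∨`, where the identification is induced by the Hodge form:
`π₂(v) = h(·, v̄) = i Q_ℂ(·, v)`. -/
def pi2 (b : ℂ) : HFibre g →ₗ[ℂ] D.Edual b :=
  Complex.I • (complexForm D.Q).flip.compl₂ (D.E b).subtype

open Classical in
/-- The smooth splitting `ι₂ : E^∨ → H` with image the conjugate of `E`
(for `b ∈ B` the condition holds, see `pi2_bijective`). -/
def iota2 (b : ℂ) : D.Edual b →ₗ[ℂ] HFibre g :=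
  if h : Function.Bijective ((D.pi2 b).domRestrict (D.Ebar b)) then
    (D.Ebar b).subtype ∘ₗ
      ((LinearEquiv.ofBijective ((D.pi2 b).domRestrict (D.Ebar b)) h).symm : _ →ₗ[ℂ] D.Ebar b)
  else 0

/-! Sanity facts: over `B` the two conditional definitions above are never in the default case,
and the projections and inclusions satisfy the expected relations. -/

lemma mem_Ebar {b : ℂ} {v : HFibre g} : v ∈ D.Ebar b ↔ star v ∈ D.E b := by
  simp [Ebar]

lemma pi2_apply (b : ℂ) (v : HFibre g) (u : D.E b) :
    D.pi2 b v u = Complex.I * complexForm D.Q u v := by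
  simp [pi2]

lemma finrank_E {b : ℂ} (hb : b ∈ B) : Module.finrank ℂ (D.E b) = g := by
  obtain ⟨W, -, hbW, -, e, -, he⟩ := D.local_frame b hb
  obtain ⟨hli, hsp⟩ := he b hbW
  rw [← hsp, finrank_span_eq_card hli, Fintype.card_fin]

lemma finrank_Ebar {b : ℂ} (hb : b ∈ B) : Module.finrank ℂ (D.Ebar b) = g := by
  refine Eq.trans ?_ (D.finrank_E hb)
  let j : D.Ebar b ≃+ D.E b :=
    { toFun := fun v => ⟨star v.1, D.mem_Ebar.1 v.2⟩
      invFun := fun v => ⟨star v.1, D.mem_Ebar.2 (by simp)⟩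
      left_inv := fun v => by simp
      right_inv := fun v => by simp
      map_add' := fun v w => by ext; simp }
  have h := rank_eq_of_equiv_equiv (starRingEnd ℂ) j (starRingAut (R := ℂ)).bijective
    (fun r m => Subtype.ext (star_smul r m.1))
  exact congrArg Cardinal.toNat h

lemma disjoint_E_Ebar {b : ℂ} (hb : b ∈ B) : Disjoint (D.E b) (D.Ebar b) := by
  rw [Submodule.disjoint_def]
  intro v hv hv'
  by_contra h0
  have h1 := D.pos b hb v hv h0
  rw [D.isotropic b hb v hv _ (D.mem_Ebar.1 hv')] at h1
  simp at h1

lemma isCompl {b : ℂ} (hb : b ∈ B) : IsCompl (D.E b) (D.Ebar b) := by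
  refine ⟨D.disjoint_E_Ebar hb, ?_⟩
  rw [codisjoint_iff]
  apply Submodule.eq_top_of_finrank_eq
  have h := Submodule.finrank_sup_add_finrank_inf_eq (D.E b) (D.Ebar b)
  rw [(D.disjoint_E_Ebar hb).eq_bot, finrank_bot, D.finrank_E hb, D.finrank_Ebar hb] at h
  rw [Module.finrank_fin_fun]
  omega

lemma pi2_bijective {b : ℂ} (hb : b ∈ B) :
    Function.Bijective ((D.pi2 b).domRestrict (D.Ebar b)) := by
  have hinj : Function.Injective ((D.pi2 b).domRestrict (D.Ebar b)) := by
    rw [injective_iff_map_eq_zero]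
    intro v hv
    by_contra h0
    have hs : star v.1 ∈ D.E b := D.mem_Ebar.1 v.2
    have h0' : star v.1 ≠ 0 := by
      intro h
      exact h0 (Subtype.ext (star_eq_zero.1 h))
    have h1 := D.pos b hb _ hs h0'
    have h2 := congrArg (fun f => f ⟨star v.1, hs⟩) hv
    simp only [LinearMap.domRestrict_apply, pi2_apply, LinearMap.zero_apply] at h2
    rw [star_star, h2] at h1
    simp at h1
  refine ⟨hinj, ?_⟩
  refine (LinearMap.injective_iff_surjective_of_finrank_eq_finrank ?_).1 hinj
  rw [Subspace.dual_finrank_eq, D.finrank_E hb, D.finrank_Ebar hb]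

lemma pi1_iota1 {b : ℂ} (hb : b ∈ B) (u : D.E b) : D.pi1 b (D.iota1 b u) = u := by
  rw [pi1, dif_pos (D.isCompl hb)]
  simp

lemma iota2_mem {b : ℂ} (hb : b ∈ B) (φ : D.Edual b) : D.iota2 b φ ∈ D.Ebar b := by
  rw [iota2, dif_pos (D.pi2_bijective hb)]
  simp

lemma pi2_iota2 {b : ℂ} (hb : b ∈ B) (φ : D.Edual b) : D.pi2 b (D.iota2 b φ) = φ := by
  rw [iota2, dif_pos (D.pi2_bijective hb)]
  exact (LinearEquiv.ofBijective _ (D.pi2_bijective hb)).apply_symm_apply φ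

lemma pi2_iota1 {b : ℂ} (hb : b ∈ B) (u : D.E b) : D.pi2 b (D.iota1 b u) = 0 := by
  ext v
  rw [pi2_apply]
  simp [D.isotropic b hb v v.2 u u.2]

lemma iota1_pi1_add_iota2_pi2 {b : ℂ} (hb : b ∈ B) (v : HFibre g) :
    D.iota1 b (D.pi1 b v) + D.iota2 b (D.pi2 b v) = v := by
  obtain ⟨u, hu, w, hw, rfl⟩ := Submodule.mem_sup.1
    ((D.isCompl hb).sup_eq_top ▸ Submodule.mem_top : v ∈ D.E b ⊔ D.Ebar b)
  have h1 : D.pi1 b w = 0 := by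
    rw [pi1, dif_pos (D.isCompl hb)]
    simpa using hw
  have h2 : D.iota2 b (D.pi2 b w) = w := by
    have h := D.pi2_iota2 hb (D.pi2 b w)
    have := (D.pi2_bijective hb).1 (a₁ := ⟨_, D.iota2_mem hb (D.pi2 b w)⟩) (a₂ := ⟨w, hw⟩)
      (by simpa using h)
    exact congrArg Subtype.val this
  have h3 := D.pi1_iota1 hb ⟨u, hu⟩
  have h4 := D.pi2_iota1 hb ⟨u, hu⟩
  simp only [iota1, Submodule.subtype_apply] at h3 h4
  simp [h1, h2, h3, h4]

/-! Sections are families of vectors indexed by all of `ℂ`; only their values on the open set `W`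
under consideration matter. -/

/-- Families of vectors in the fibres of `E`. -/
abbrev SecE : Type := (b : ℂ) → D.E b

/-- Families of vectors in the fibres of `E^∨`. -/
abbrev SecEdual : Type := (b : ℂ) → D.Edual b

/-- Families of fibrewise linear maps `E_b → E_b^∨`. -/
abbrev Mor : Type := (b : ℂ) → D.E b →ₗ[ℂ] D.Edual b

/-- `α ∈ Γ(W, 𝒜(E))`: a smooth section of `E` over `W`. -/
def IsSmoothSection (W : Set ℂ) (α : D.SecE) : Prop :=
  ContDiffOn ℝ ∞ (fun b => D.iota1 b (α b)) W

/-- `α ∈ Γ(W, E)`: a holomorphic section of `E` over `W`. -/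
def IsHolSection (W : Set ℂ) (α : D.SecE) : Prop :=
  DifferentiableOn ℂ (fun b => D.iota1 b (α b)) W

/-- The Higgs field `θ = π₂ ∘ ∇ ∘ ι₁`, from sections of `E` to `E^∨`-valued `1`-forms. -/
def higgs (α : D.SecE) (b : ℂ) : ℂ →ₗ[ℝ] D.Edual b :=
  (D.pi2 b).restrictScalars ℝ ∘ₗ gaussManin (fun z => D.iota1 z (α z)) b

/-- `∇^E_t = π₁ ∘ ∇_t ∘ ι₁`. -/
def nablaE (α : D.SecE) : D.SecE :=
  fun b => D.pi1 b (gaussManinDt (fun z => D.iota1 z (α z)) b)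

/-- `∇^{E^∨}_t = π₂ ∘ ∇_t ∘ ι₂`. -/
def nablaEdual (φ : D.SecEdual) : D.SecEdual :=
  fun b => D.pi2 b (gaussManinDt (fun z => D.iota2 z (φ z)) b)

/-- The morphism `η` has the form `ι_{∂/∂t} θ`:
`η(α) = ι_{∂/∂t} (θ(α))` for all smooth sections `α` of `E` over open subsets of `B`. -/
def IsContractedHiggs (η : D.Mor) : Prop :=
  ∀ W : Set ℂ, IsOpen W → W ⊆ B → ∀ α : D.SecE, D.IsSmoothSection W α →
    ∀ b ∈ W, η b (α b) = contrDt (D.higgs α b)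

/-- `η' = ∇^H_t η`, i.e. `η'(α) = ∇^{E^∨}_t (η(α)) - η(∇^E_t α)` for all smooth sections `α`
of `E` over open subsets of `B`. -/
def IsNablaH (η η' : D.Mor) : Prop :=
  ∀ W : Set ℂ, IsOpen W → W ⊆ B → ∀ α : D.SecE, D.IsSmoothSection W α →
    ∀ b ∈ W, η' b (α b) = D.nablaEdual (fun z => η z (α z)) b - η b (D.nablaE α b)

/-- The endomorphism `ι₁ ∘ π₁` of the fibre `V_ℂ` of `H`. -/
def projE (b : ℂ) : HFibre g →L[ℂ] HFibre g :=
  LinearMap.toContinuousLinearMap (D.iota1 b ∘ₗ D.pi1 b)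

/-- The endomorphism `ι₂ ∘ η ∘ π₁` of the fibre `V_ℂ` of `H`. -/
def extendMor (η : D.Mor) (b : ℂ) : HFibre g →L[ℂ] HFibre g :=
  LinearMap.toContinuousLinearMap (D.iota2 b ∘ₗ η b ∘ₗ D.pi1 b)

/-- `ι_{∂/∂t} θ` as a bundle map: on `e ∈ E_b` it is `ι_{∂/∂t} θ(α)` at `b` for the smooth section
`α(z) = π₁(z) e` of `E`, which takes the value `e` at `b`. -/
def contractedHiggs : D.Mor :=
  fun b => D.pi2 b ∘ₗ (derivDt D.projE b).toLinearMap ∘ₗ D.iota1 b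

/-- `∇^H_t η` as a bundle map: on `e ∈ E_b` it is `∇^{E^∨}_t (η(α)) - η(∇^E_t α)` at `b` for the
smooth section `α(z) = π₁(z) e` of `E`, which takes the value `e` at `b`. -/
def nablaH (η : D.Mor) : D.Mor :=
  fun b => D.pi2 b ∘ₗ (derivDt (D.extendMor η) b).toLinearMap ∘ₗ D.iota1 b
    - η b ∘ₗ D.pi1 b ∘ₗ (derivDt D.projE b).toLinearMap ∘ₗ D.iota1 b

/-- `η^{(k)} = (∇^H_t)^{k-1} (ι_{∂/∂t} θ)` for `k ≥ 1`. -/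
def eta (k : ℕ) : D.Mor := D.nablaH^[k - 1] D.contractedHiggs

/-- Smoothness over `B` of a family of maps `E_b → E_b^∨`, tested on smooth sections of `E`. -/
def IsSmoothMor (η : D.Mor) : Prop :=
  ∀ W : Set ℂ, IsOpen W → W ⊆ B → ∀ α β : D.SecE, D.IsSmoothSection W α → D.IsSmoothSection W β →
    ContDiffOn ℝ ∞ (fun b => η b (α b) (β b)) W

/-- Symmetry over `B` of a family of maps `E_b → E_b^∨`. -/
def IsSymmMor (η : D.Mor) : Prop :=
  ∀ b ∈ B, ∀ u v : D.E b, η b u v = η b v u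

/-- `σ ∈ Γ(W, 𝕌)`: a holomorphic section `σ` of `E` with `∇(ι₁ σ) = 0`. -/
def IsFlatSection (W : Set ℂ) (σ : D.SecE) : Prop :=
  D.IsHolSection W σ ∧ ∀ b ∈ W, gaussManin (fun z => D.iota1 z (σ z)) b = 0

/-- `α ∈ Γ(W, 𝒰)` for the subsheaf `𝒰 = 𝕌 ⊗ O_B` of `E`: locally on `W`, `α` is a combination
`∑ fᵢ σᵢ` of sections `σᵢ` of `𝕌` with holomorphic coefficients. -/
def IsSectionU (W : Set ℂ) (α : D.SecE) : Prop :=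
  ∀ p ∈ W, ∃ W' : Set ℂ, IsOpen W' ∧ p ∈ W' ∧ W' ⊆ W ∧
    ∃ (n : ℕ) (σ : Fin n → D.SecE) (f : Fin n → ℂ → ℂ),
      (∀ i, D.IsFlatSection W' (σ i)) ∧ (∀ i, DifferentiableOn ℂ (f i) W') ∧
        ∀ z ∈ W', α z = ∑ i, f i z • σ i z

/-- `α ∈ Γ(W, 𝒦^{(r)})`: a holomorphic section of `E` killed by `η^{(1)}, …, η^{(r)}`. -/
def IsSectionK (r : ℕ) (W : Set ℂ) (α : D.SecE) : Prop :=
  D.IsHolSection W α ∧ ∀ k, 1 ≤ k → k ≤ r → ∀ b ∈ W, D.eta k b (α b) = 0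

lemma IsHolSection.mono {W W' : Set ℂ} {α : D.SecE} (h : D.IsHolSection W α) (hW : W' ⊆ W) :
    D.IsHolSection W' α :=
  DifferentiableOn.mono h hW

lemma IsFlatSection.mono {W W' : Set ℂ} {α : D.SecE} (h : D.IsFlatSection W α) (hW : W' ⊆ W) :
    D.IsFlatSection W' α :=
  ⟨IsHolSection.mono D h.1 hW, fun b hb => h.2 b (hW hb)⟩

lemma IsSectionU.add {W₁ W₂ : Set ℂ} {α β : D.SecE} (hα : D.IsSectionU W₁ α)
    (hβ : D.IsSectionU W₂ β) : D.IsSectionU (W₁ ∩ W₂) (α + β) := by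
  rintro p ⟨hp₁, hp₂⟩
  obtain ⟨V₁, hV₁, hpV₁, hVW₁, n, σ, f, hσ, hf, h⟩ := hα p hp₁
  obtain ⟨V₂, hV₂, hpV₂, hVW₂, m, τ, f', hτ, hf', h'⟩ := hβ p hp₂
  refine ⟨V₁ ∩ V₂, hV₁.inter hV₂, ⟨hpV₁, hpV₂⟩, Set.inter_subset_inter hVW₁ hVW₂, n + m,
    Fin.append σ τ, Fin.append f f', fun i => ?_, fun i => ?_, fun z hz => ?_⟩
  · refine Fin.addCases (fun i => ?_) (fun i => ?_) i
    · rw [Fin.append_left]; exact IsFlatSection.mono D (hσ i) Set.inter_subset_left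
    · rw [Fin.append_right]; exact IsFlatSection.mono D (hτ i) Set.inter_subset_right
  · refine Fin.addCases (fun i => ?_) (fun i => ?_) i
    · rw [Fin.append_left]; exact (hf i).mono Set.inter_subset_left
    · rw [Fin.append_right]; exact (hf' i).mono Set.inter_subset_right
  · rw [Fin.sum_univ_add, Pi.add_apply, h z hz.1, h' z hz.2]
    simp only [Fin.append_left, Fin.append_right]

lemma IsSectionU.smul {W : Set ℂ} {α : D.SecE} (c : ℂ) (hα : D.IsSectionU W α) :
    D.IsSectionU W (c • α) := by
  intro p hp
  obtain ⟨V, hV, hpV, hVW, n, σ, f, hσ, hf, h⟩ := hα p hp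
  refine ⟨V, hV, hpV, hVW, n, σ, fun i => c • f i, hσ, fun i => (hf i).const_smul c,
    fun z hz => ?_⟩
  rw [Pi.smul_apply, h z hz, Finset.smul_sum]
  exact Finset.sum_congr rfl fun i _ => (smul_assoc c (f i z) (σ i z)).symm

/-- The fibre `𝒰_b ⊆ E_b` at `b ∈ B`: the values at `b` of the sections of `𝒰` near `b`. -/
def fibreU (b : ℂ) : Submodule ℂ (D.E b) where
  carrier := {u | ∃ W : Set ℂ, IsOpen W ∧ b ∈ W ∧ ∃ α : D.SecE, D.IsSectionU W α ∧ α b = u}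
  add_mem' := by
    rintro _ _ ⟨W₁, hW₁, hb₁, α, hα, rfl⟩ ⟨W₂, hW₂, hb₂, β, hβ, rfl⟩
    exact ⟨W₁ ∩ W₂, hW₁.inter hW₂, ⟨hb₁, hb₂⟩, α + β, IsSectionU.add D hα hβ, rfl⟩
  zero_mem' := ⟨Set.univ, isOpen_univ, Set.mem_univ b, 0, fun p _ =>
    ⟨Set.univ, isOpen_univ, Set.mem_univ p, subset_rfl, 0, Fin.elim0, Fin.elim0,
      fun i => i.elim0, fun i => i.elim0, fun z _ => by simp⟩, rfl⟩
  smul_mem' := by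
    rintro c _ ⟨W, hW, hb, α, hα, rfl⟩
    exact ⟨W, hW, hb, c • α, IsSectionU.smul D c hα, rfl⟩

end PVHS

/-- `Z` is a (closed) analytic subset of the open set `B ⊆ ℂ`: near every point of `B` it is the
set of common zeros of finitely many holomorphic functions. -/
def IsAnalyticSubset (B Z : Set ℂ) : Prop :=
  Z ⊆ B ∧ ∀ p ∈ B, ∃ W : Set ℂ, IsOpen W ∧ p ∈ W ∧ W ⊆ B ∧
    ∃ (n : ℕ) (f : Fin n → ℂ → ℂ), (∀ i, DifferentiableOn ℂ (f i) W) ∧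
      ∀ z ∈ W, z ∈ Z ↔ ∀ i, f i z = 0

/-- `G` is a dense (analytic) Zariski-open subset of the open set `B ⊆ ℂ`. -/
def IsDenseZariskiOpen (B G : Set ℂ) : Prop :=
  G ⊆ B ∧ IsAnalyticSubset B (B \ G) ∧ B ⊆ closure G

end

/-!
The iterated Higgs fields are the derivatives of a single object, the Hodge projector
`P = ι₁ π₁ : V_ℂ → E ⊆ V_ℂ`. Since `∂/∂t` preserves smooth sections of the conjugate of `E`, the
derivative `∂P/∂t` kills the conjugate of `E`, and by `P² = P` it maps `E` to the conjugate. It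
follows by induction that `ι₂ η⁽ᵏ⁾ π₁ = ∂ᵏP/∂tᵏ` (`PVHS.extendMor_eta`). This gives smoothness and,
by differentiating `Q(P u, v) + Q(u, P v) = Q(u, v)`, symmetry.

Let `e` be a local holomorphic frame of `E`. Expanding the derivatives of `eᵢ = P eᵢ` by the Leibniz
rule shows that `u ∈ E_b` is killed by `η⁽¹⁾, …, η⁽ʳ⁾` if and only if it is `Q`-orthogonal to all
derivatives `eᵢ⁽ⁿ⁾(b)` with `n ≤ r` (`PVHS.projDt_eq_zero_iff`), a holomorphic condition.

On the other hand, let `F = ⋂_z E_z`, the space of global flat sections of `E`; by the identity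
theorem every local flat section is a section of `F`, and all fibres of the flat unitary bundle are
`F` (`PVHS.mem_fibreU_iff`). As `E` is its own orthogonal complement, `u ∈ F` if and only if `u` is
orthogonal to the derivatives `eᵢ⁽ⁿ⁾(b)` of all orders.

Near a given point `p` the two conditions agree for `r = g`, except possibly at `p` itself. Over the
field of meromorphic germs at `p`, the spans of the derivatives of order at most `m` form an
increasing sequence of subspaces of a space of dimension `2g`, which starts in dimension `g` and so
is stationary at some step `m ≤ g`. The resulting relations hold on a punctured neighbourhood of
`p`, where they can be differentiated, so there the derivatives of order at most `g` span those of
all orders (`eventually_iterate_deriv_mem_span`). Hence the points where the common kernel of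
`η⁽¹⁾, …, η⁽ᵍ⁾` is larger than `F` do not accumulate in the disk (`PVHS.eventually_mem_flatPart`),
which is the second statement, and a section killed by these fields has values in `F` by continuity,
which is the first.
-/

noncomputable section

open Filter Topology

/-! ### Wirtinger calculus -/

section Wirtinger

variable {F G H : Type*} [NormedAddCommGroup F] [NormedSpace ℂ F]
  [NormedAddCommGroup G] [NormedSpace ℂ G] [NormedAddCommGroup H] [NormedSpace ℂ H]

lemma derivDt_apply (f : ℂ → F) (b : ℂ) :
    derivDt f b = (1 / 2 : ℂ) • (fderiv ℝ f b 1 - Complex.I • fderiv ℝ f b Complex.I) := rfl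

lemma derivDt_congr {f f' : ℂ → F} {b : ℂ} (h : f =ᶠ[𝓝 b] f') : derivDt f b = derivDt f' b := by
  rw [derivDt_apply, derivDt_apply, h.fderiv_eq]

lemma iterate_derivDt_congr {f f' : ℂ → F} {W : Set ℂ} (hW : IsOpen W) (h : Set.EqOn f f' W)
    (n : ℕ) : Set.EqOn (derivDt^[n] f) (derivDt^[n] f') W := by
  induction n with
  | zero => exact h
  | succ n ih =>
    intro b hb
    rw [Function.iterate_succ_apply', Function.iterate_succ_apply']
    exact derivDt_congr (ih.eventuallyEq_of_mem (hW.mem_nhds hb))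

lemma derivDt_const (v : F) (b : ℂ) : derivDt (fun _ => v) b = 0 := by
  simp [derivDt_apply]

/-- On holomorphic functions `∂/∂t` is the complex derivative. -/
lemma derivDt_eq_deriv {f : ℂ → F} {b : ℂ} (hf : DifferentiableAt ℂ f b) :
    derivDt f b = deriv f b := by
  have h : fderiv ℝ f b = (fderiv ℂ f b).restrictScalars ℝ :=
    (hf.hasFDerivAt.restrictScalars ℝ).fderiv
  have h2 : fderiv ℂ f b Complex.I = Complex.I • deriv f b := by
    rw [← fderiv_apply_one_eq_deriv, ← map_smul, smul_eq_mul, mul_one]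
  rw [derivDt_apply, h, ContinuousLinearMap.coe_restrictScalars', h2, smul_smul,
    Complex.I_mul_I, fderiv_apply_one_eq_deriv]
  module

lemma iterate_derivDt_eq_iterate_deriv [CompleteSpace F] {f : ℂ → F} {W : Set ℂ} (hW : IsOpen W)
    (hf : DifferentiableOn ℂ f W) (n : ℕ) : Set.EqOn (derivDt^[n] f) (deriv^[n] f) W := by
  induction n with
  | zero => exact fun _ _ => rfl
  | succ n ih =>
    intro b hb
    have hd : AnalyticAt ℂ (deriv^[n] f) b :=
      (hf.analyticAt (hW.mem_nhds hb)).iterated_deriv n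
    rw [Function.iterate_succ_apply', Function.iterate_succ_apply',
      derivDt_congr (ih.eventuallyEq_of_mem (hW.mem_nhds hb)),
      derivDt_eq_deriv hd.differentiableAt]

lemma ContDiffOn.derivDt {f : ℂ → F} {W : Set ℂ} (hW : IsOpen W) (hf : ContDiffOn ℝ ∞ f W) :
    ContDiffOn ℝ ∞ (derivDt f) W := by
  have h : ContDiffOn ℝ ∞ (fderiv ℝ f) W := hf.fderiv_of_isOpen hW (by simp)
  have h1 : ∀ v : ℂ, ContDiffOn ℝ ∞ (fun b => fderiv ℝ f b v) W := fun v =>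
    h.clm_apply contDiffOn_const
  exact ((h1 1).sub ((h1 Complex.I).const_smul Complex.I)).const_smul (1 / 2 : ℂ)

lemma ContDiffOn.iterate_derivDt {f : ℂ → F} {W : Set ℂ} (hW : IsOpen W)
    (hf : ContDiffOn ℝ ∞ f W) (n : ℕ) : ContDiffOn ℝ ∞ (_root_.derivDt^[n] f) W := by
  induction n with
  | zero => exact hf
  | succ n ih =>
    rw [Function.iterate_succ']
    exact ih.derivDt hW

lemma derivDt_sum {ι : Type*} (s : Finset ι) {f : ι → ℂ → F} {b : ℂ}
    (hf : ∀ i ∈ s, DifferentiableAt ℝ (f i) b) :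
    derivDt (fun z => ∑ i ∈ s, f i z) b = ∑ i ∈ s, derivDt (f i) b := by
  simp only [derivDt_apply, fderiv_fun_sum hf, sum_apply, Finset.smul_sum,
    Finset.sum_sub_distrib, smul_sub]

lemma derivDt_nsmul (n : ℕ) {f : ℂ → F} {b : ℂ} (hf : DifferentiableAt ℝ f b) :
    derivDt (fun z => n • f z) b = n • derivDt f b := by
  simp only [derivDt_apply, fderiv_fun_const_smul hf, smul_apply]
  module

lemma ContDiffOn.bilin (ψ : F →L[ℂ] G →L[ℂ] H) {f : ℂ → F} {u : ℂ → G} {W : Set ℂ}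
    (hf : ContDiffOn ℝ ∞ f W) (hu : ContDiffOn ℝ ∞ u W) :
    ContDiffOn ℝ ∞ (fun z => ψ (f z) (u z)) W := by
  have h := (ψ.isBoundedBilinearMap.contDiff (n := ∞)).restrict_scalars ℝ
  exact h.comp_contDiffOn (hf.prodMk hu)

/-- The product rule for `∂/∂t`. -/
lemma derivDt_bilin (ψ : F →L[ℂ] G →L[ℂ] H) {f : ℂ → F} {u : ℂ → G} {b : ℂ}
    (hf : DifferentiableAt ℝ f b) (hu : DifferentiableAt ℝ u b) :
    derivDt (fun z => ψ (f z) (u z)) b = ψ (derivDt f b) (u b) + ψ (f b) (derivDt u b) := by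
  have h0 := ((ψ.isBoundedBilinearMap.hasFDerivAt (f b, u b)).restrictScalars ℝ).comp b
    (hf.hasFDerivAt.prodMk hu.hasFDerivAt)
  have h : HasFDerivAt (fun z => ψ (f z) (u z)) _ b := h0
  simp only [derivDt_apply, h.fderiv]
  simp only [ContinuousLinearMap.comp_apply, ContinuousLinearMap.coe_restrictScalars',
    ContinuousLinearMap.prod_apply, IsBoundedBilinearMap.deriv_apply, map_smul, map_sub,
    smul_apply, sub_apply]
  module

lemma derivDt_clm (L : F →L[ℂ] G) {f : ℂ → F} {b : ℂ} (hf : DifferentiableAt ℝ f b) :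
    derivDt (fun z => L (f z)) b = L (derivDt f b) := by
  have h := derivDt_bilin (ContinuousLinearMap.id ℂ (F →L[ℂ] G)) (f := fun _ => L) (b := b)
    (differentiableAt_const _) hf
  simpa [derivDt_const] using h

/-- The Leibniz rule for the iterates of `∂/∂t`. -/
lemma iterate_derivDt_bilin (ψ : F →L[ℂ] G →L[ℂ] H) {f : ℂ → F} {u : ℂ → G} {W : Set ℂ}
    (hW : IsOpen W) (hf : ContDiffOn ℝ ∞ f W) (hu : ContDiffOn ℝ ∞ u W) (n : ℕ) :
    ∀ b ∈ W, derivDt^[n] (fun z => ψ (f z) (u z)) b =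
      ∑ ij ∈ Finset.HasAntidiagonal.antidiagonal n,
        n.choose ij.1 • ψ (derivDt^[ij.1] f b) (derivDt^[ij.2] u b) := by
  induction n with
  | zero => simp
  | succ n ih =>
    intro b hb
    have hf' : ∀ k, DifferentiableAt ℝ (derivDt^[k] f) b := fun k =>
      ((hf.iterate_derivDt hW k).contDiffAt (hW.mem_nhds hb)).differentiableAt (by simp)
    have hu' : ∀ k, DifferentiableAt ℝ (derivDt^[k] u) b := fun k =>
      ((hu.iterate_derivDt hW k).contDiffAt (hW.mem_nhds hb)).differentiableAt (by simp)
    have hψ : ∀ i j, DifferentiableAt ℝ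
        (fun z => ψ (derivDt^[i] f z) (derivDt^[j] u z)) b := fun i j =>
      ((ContDiffOn.bilin ψ (hf.iterate_derivDt hW i) (hu.iterate_derivDt hW j)).contDiffAt
        (hW.mem_nhds hb)).differentiableAt (by simp)
    rw [Function.iterate_succ_apply',
      derivDt_congr (Set.EqOn.eventuallyEq_of_mem (s := W) ih (hW.mem_nhds hb)),
      Finset.sum_antidiagonal_choose_succ_nsmul
        (fun i j => ψ (derivDt^[i] f b) (derivDt^[j] u b)) n, ← Finset.sum_add_distrib]
    rw [derivDt_sum _ (f := fun (ij : ℕ × ℕ) z =>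
        n.choose ij.1 • ψ (derivDt^[ij.1] f z) (derivDt^[ij.2] u z))
      fun ij _ => (hψ _ _).fun_const_smul _]
    refine Finset.sum_congr rfl fun ij hij => ?_
    rw [derivDt_nsmul _ (hψ _ _), derivDt_bilin ψ (hf' _) (hu' _),
      n.choose_symm_of_eq_add (Finset.HasAntidiagonal.mem_antidiagonal.1 hij).symm, smul_add,
      Function.iterate_succ_apply', Function.iterate_succ_apply', add_comm]

/-- The derivative `∂/∂t` kills antiholomorphic functions. -/
lemma derivDt_star_eq_zero {n : ℕ} {e : ℂ → Fin n → ℂ} {b : ℂ} (he : DifferentiableAt ℂ e b) :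
    derivDt (fun z => star (e z)) b = 0 := by
  have h0 := (starL' ℝ : (Fin n → ℂ) ≃L[ℝ] (Fin n → ℂ)).hasFDerivAt.comp b
    (he.hasFDerivAt.restrictScalars ℝ)
  have h : HasFDerivAt (fun z => star (e z)) _ b := h0
  have h2 : fderiv ℂ e b Complex.I = Complex.I • fderiv ℂ e b 1 := by
    rw [← map_smul, smul_eq_mul, mul_one]
  rw [derivDt_apply, h.fderiv]
  simp only [ContinuousLinearMap.comp_apply, ContinuousLinearMap.coe_restrictScalars',
    ContinuousLinearEquiv.coe_coe, starL'_apply, h2, star_smul, smul_smul]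
  simp

end Wirtinger

/-! ### The Hodge projector -/

namespace PVHS

variable {g : ℕ} {B : Set ℂ} (D : PVHS g B)

lemma isOpen_base (D : PVHS g B) : IsOpen B := by
  rw [isOpen_iff_mem_nhds]
  intro b hb
  obtain ⟨W, hW, hbW, hWB, -⟩ := D.local_frame b hb
  exact mem_of_superset (hW.mem_nhds hbW) hWB

lemma projE_apply (b : ℂ) (v : HFibre g) : D.projE b v = D.pi1 b v := rfl

lemma projE_mem (b : ℂ) (v : HFibre g) : D.projE b v ∈ D.E b := (D.pi1 b v).2

lemma projE_of_mem {b : ℂ} (hb : b ∈ B) {v : HFibre g} (hv : v ∈ D.E b) : D.projE b v = v :=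
  congrArg Subtype.val (D.pi1_iota1 hb ⟨v, hv⟩)

lemma pi1_of_mem_Ebar {b : ℂ} (hb : b ∈ B) {v : HFibre g} (hv : v ∈ D.Ebar b) :
    D.pi1 b v = 0 := by
  rw [pi1, dif_pos (D.isCompl hb)]
  simpa using hv

lemma projE_of_mem_Ebar {b : ℂ} (hb : b ∈ B) {v : HFibre g} (hv : v ∈ D.Ebar b) :
    D.projE b v = 0 := by
  rw [projE_apply, D.pi1_of_mem_Ebar hb hv, Submodule.coe_zero]

lemma sub_projE_mem_Ebar {b : ℂ} (hb : b ∈ B) (v : HFibre g) : v - D.projE b v ∈ D.Ebar b := by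
  have h : v - D.projE b v = D.iota2 b (D.pi2 b v) :=
    sub_eq_of_eq_add' (D.iota1_pi1_add_iota2_pi2 hb v).symm
  rw [h]
  exact D.iota2_mem hb _

lemma star_mem_Ebar {b : ℂ} {v : HFibre g} (hv : v ∈ D.E b) : star v ∈ D.Ebar b :=
  D.mem_Ebar.2 (by rwa [star_star])

lemma pi1_star {b : ℂ} (hb : b ∈ B) (v : HFibre g) :
    (D.pi1 b (star v) : HFibre g) = star (v - D.projE b v) := by
  have h : star v = star (v - D.projE b v) + star (D.projE b v) := by simp
  conv_lhs => rw [h, map_add, D.pi1_of_mem_Ebar hb (D.star_mem_Ebar (D.projE_mem b v)), add_zero]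
  exact D.projE_of_mem hb (D.mem_Ebar.1 (D.sub_projE_mem_Ebar hb v))

/-- The projector `P = ι₁ π₁` onto `E` along its conjugate varies smoothly. Near `p ∈ B` it is
`L P(p) L⁻¹`, where `L(z)` transports a frame of `E` and the conjugate frame from `p` to `z`. -/
lemma contDiffOn_projE : ContDiffOn ℝ ∞ D.projE B := by
  intro p hp
  obtain ⟨W, hW, hpW, hWB, e, he, hfr⟩ := D.local_frame p hp
  have hmem : ∀ z ∈ W, ∀ i, e i z ∈ D.E z := fun z hz i =>
    (hfr z hz).2 ▸ Submodule.subset_span (Set.mem_range_self i)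
  let bas : Module.Basis (Fin g) ℂ (D.E p) :=
    Module.Basis.mk (v := fun i => (⟨e i p, hmem p hpW i⟩ : D.E p))
      (LinearIndependent.of_comp (D.E p).subtype (hfr p hpW).1) (by
        rw [← Submodule.map_le_map_iff_of_injective (D.E p).injective_subtype, Submodule.map_span,
          ← Set.range_comp]
        rw [Submodule.map_subtype_top]
        exact (hfr p hpW).2.ge)
  have hbas : ∀ i, (bas i : HFibre g) = e i p := fun i => by simp [bas]
  let φ : Fin g → HFibre g →L[ℂ] ℂ := fun i =>
    LinearMap.toContinuousLinearMap (bas.coord i ∘ₗ D.pi1 p)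
  let ψ : Fin g → HFibre g →L[ℂ] ℂ := fun i => LinearMap.toContinuousLinearMap
    { toFun := fun v => star (φ i (star v))
      map_add' := fun v w => by simp
      map_smul' := fun a v => by simp [star_smul] }
  have hφ : ∀ v, ∑ i, φ i v • e i p = D.pi1 p v := fun v => by
    have h := congrArg (D.E p).subtype (bas.sum_repr (D.pi1 p v))
    simp only [map_sum, map_smul, Submodule.subtype_apply, hbas] at h
    exact h
  have hψ : ∀ v, ∑ i, ψ i v • star (e i p) = v - D.projE p v := fun v => by
    have h := congrArg star (hφ (star v))
    rw [D.pi1_star hp, star_star, star_sum] at h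
    rw [← h]
    exact Finset.sum_congr rfl fun i _ => (star_smul _ _).symm
  let L : ℂ → HFibre g →L[ℂ] HFibre g := fun z =>
    ∑ i, ((φ i).smulRight (e i z) + (ψ i).smulRight (star (e i z)))
  have hL : ∀ z v, L z v = ∑ i, φ i v • e i z + ∑ i, ψ i v • star (e i z) := fun z v => by
    simp [L, sum_apply, Finset.sum_add_distrib]
  have hL1 : L p = 1 := by
    ext1 v
    rw [hL, hφ, hψ, ← projE_apply]
    simp
  have hes : ∀ i, ContDiffOn ℝ ∞ (e i) W := fun i =>
    ((he i).contDiffOn hW).restrict_scalars ℝ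
  have hLs : ContDiffAt ℝ ∞ L p := by
    have h : ContDiffOn ℝ ∞ L W := by
      refine ContDiffOn.sum fun i _ => ContDiffOn.add ?_ ?_
      · exact ContDiffOn.bilin (ContinuousLinearMap.smulRightL ℂ (HFibre g) (HFibre g))
          contDiffOn_const (hes i)
      · exact ContDiffOn.bilin (ContinuousLinearMap.smulRightL ℂ (HFibre g) (HFibre g))
          contDiffOn_const
          ((starL' ℝ : HFibre g ≃L[ℝ] HFibre g).contDiff.comp_contDiffOn (hes i))
    exact h.contDiffAt (hW.mem_nhds hpW)
  have hcomm : ∀ z ∈ W, D.projE z * L z = L z * D.projE p := fun z hz => by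
    ext1 v
    have h1 : ∀ i, φ i (D.projE p v) = φ i v := fun i =>
      congrArg (bas.coord i) (D.pi1_iota1 hp (D.pi1 p v))
    have h2 : ∀ i, ψ i (D.projE p v) = 0 := fun i => by
      have h : D.pi1 p (star (D.projE p v)) = 0 :=
        D.pi1_of_mem_Ebar hp (D.star_mem_Ebar (D.projE_mem p v))
      simp [ψ, φ, h]
    simp only [mul_apply_eq_comp, hL, h1, h2, map_add, map_sum, map_smul,
      D.projE_of_mem (hWB hz) (hmem z hz _),
      D.projE_of_mem_Ebar (hWB hz) (D.star_mem_Ebar (hmem z hz _))]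
    simp
  have hunit : ∀ᶠ z in 𝓝 p, IsUnit (L z) := by
    have h : {x : HFibre g →L[ℂ] HFibre g | IsUnit x} ∈ 𝓝 (L p) :=
      Units.isOpen.mem_nhds (by simp [hL1])
    exact hLs.continuousAt h
  have hinv : ContDiffAt ℝ ∞ (fun z => Ring.inverse (L z)) p := by
    have h := contDiffAt_ringInverse ℝ (n := ∞) (1 : (HFibre g →L[ℂ] HFibre g)ˣ)
    rw [Units.val_one, ← hL1] at h
    exact h.comp p hLs
  have hev : D.projE =ᶠ[𝓝 p] fun z => L z * D.projE p * Ring.inverse (L z) := by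
    filter_upwards [hunit, hW.mem_nhds hpW] with z hz hzW
    rw [← hcomm z hzW, mul_assoc, Ring.mul_inverse_cancel _ hz, mul_one]
  exact (((hLs.mul contDiffAt_const).mul hinv).congr_of_eventuallyEq hev).contDiffWithinAt

end PVHS

/-! ### The polarization -/

namespace PVHS

variable {g : ℕ} {B : Set ℂ} (D : PVHS g B)

lemma complexForm_swap (u v : HFibre g) : complexForm D.Q u v = -complexForm D.Q v u := by
  have h : (D.Q.map (fun n : ℤ => (n : ℂ))).transpose = -D.Q.map (fun n : ℤ => (n : ℂ)) := by
    rw [← Matrix.transpose_map, D.antisymm]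
    ext i j
    simp
  rw [complexForm, Matrix.toBilin'_apply', Matrix.toBilin'_apply', Matrix.dotProduct_mulVec,
    ← Matrix.mulVec_transpose, h, Matrix.neg_mulVec, neg_dotProduct, dotProduct_comm]

lemma complexForm_star (u v : HFibre g) :
    complexForm D.Q (star u) (star v) = star (complexForm D.Q u v) := by
  simp [complexForm, Matrix.toBilin'_apply, mul_comm]

lemma complexForm_Ebar {b : ℂ} (hb : b ∈ B) {u v : HFibre g} (hu : u ∈ D.Ebar b)
    (hv : v ∈ D.Ebar b) : complexForm D.Q u v = 0 := by
  have h := D.complexForm_star u v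
  rw [D.isotropic b hb _ (D.mem_Ebar.1 hu) _ (D.mem_Ebar.1 hv)] at h
  exact star_eq_zero.1 h.symm

lemma eq_zero_of_mem_Ebar {b : ℂ} (hb : b ∈ B) {v : HFibre g} (hv : v ∈ D.Ebar b)
    (h : ∀ u ∈ D.E b, complexForm D.Q v u = 0) : v = 0 := by
  by_contra h0
  have hs := D.mem_Ebar.1 hv
  have h1 := D.pos b hb _ hs (by simpa using h0)
  rw [star_star, D.complexForm_swap, h _ hs] at h1
  simp at h1

/-- `E` is its own orthogonal complement for `Q`. -/
lemma mem_E_iff {b : ℂ} (hb : b ∈ B) {v : HFibre g} :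
    v ∈ D.E b ↔ ∀ u ∈ D.E b, complexForm D.Q v u = 0 := by
  refine ⟨fun hv u hu => D.isotropic b hb v hv u hu, fun h => ?_⟩
  have h1 : v - D.projE b v = 0 := by
    refine D.eq_zero_of_mem_Ebar hb (D.sub_projE_mem_Ebar hb v) fun u hu => ?_
    rw [map_sub, LinearMap.sub_apply, h u hu, D.isotropic b hb _ (D.projE_mem b v) u hu, sub_zero]
  rw [sub_eq_zero.1 h1]
  exact D.projE_mem b v

lemma complexForm_projE_add {b : ℂ} (hb : b ∈ B) (u v : HFibre g) :
    complexForm D.Q (D.projE b u) v + complexForm D.Q u (D.projE b v) = complexForm D.Q u v := by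
  have h1 := D.isotropic b hb _ (D.projE_mem b u) _ (D.projE_mem b v)
  have h2 := D.complexForm_Ebar hb (D.sub_projE_mem_Ebar hb u) (D.sub_projE_mem_Ebar hb v)
  simp only [map_sub, LinearMap.sub_apply] at h2
  linear_combination -h2 + h1

/-! ### Derivatives of the Hodge projector -/

/-- The `k`-th derivative `∂ᵏP/∂tᵏ` of the Hodge projector `P = ι₁ π₁`. -/
def projDt (k : ℕ) : ℂ → HFibre g →L[ℂ] HFibre g := derivDt^[k] D.projE

lemma projDt_zero : D.projDt 0 = D.projE := rfl

lemma projDt_succ (k : ℕ) : D.projDt (k + 1) = derivDt (D.projDt k) :=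
  Function.iterate_succ_apply' _ _ _

lemma contDiffOn_projDt (k : ℕ) : ContDiffOn ℝ ∞ (D.projDt k) B :=
  D.contDiffOn_projE.iterate_derivDt D.isOpen_base k

lemma differentiableAt_projDt (k : ℕ) {b : ℂ} (hb : b ∈ B) :
    DifferentiableAt ℝ (D.projDt k) b :=
  ((D.contDiffOn_projDt k).contDiffAt (D.isOpen_base.mem_nhds hb)).differentiableAt (by simp)

/-- The conjugate bundle is spanned by antiholomorphic sections, which `∂/∂t` kills. -/
lemma projDt_one_of_mem_Ebar {b : ℂ} (hb : b ∈ B) {w : HFibre g} (hw : w ∈ D.Ebar b) :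
    D.projDt 1 b w = 0 := by
  obtain ⟨W, hW, hbW, hWB, e, he, hfr⟩ := D.local_frame b hb
  have h0 := D.mem_Ebar.1 hw
  rw [← (hfr b hbW).2] at h0
  obtain ⟨a, ha⟩ := (Submodule.mem_span_range_iff_exists_fun ℂ).1 h0
  let y : ℂ → HFibre g := fun z => ∑ i, a i • e i z
  have hy : DifferentiableAt ℂ y b :=
    DifferentiableAt.fun_sum fun i _ => ((he i).differentiableAt (hW.mem_nhds hbW)).const_smul (a i)
  have hyE : ∀ z ∈ W, y z ∈ D.E z := fun z hz => by
    rw [← (hfr z hz).2]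
    exact Submodule.sum_mem _ fun i _ =>
      Submodule.smul_mem _ _ (Submodule.subset_span (Set.mem_range_self i))
  have hyb : star (y b) = w := by
    simp only [y]
    rw [ha, star_star]
  have hys : DifferentiableAt ℝ (fun z => star (y z)) b :=
    (starL' ℝ : HFibre g ≃L[ℝ] HFibre g).differentiableAt.comp b (hy.restrictScalars ℝ)
  have hev : (fun z => ContinuousLinearMap.id ℂ (HFibre g →L[ℂ] HFibre g) (D.projE z)
      (star (y z))) =ᶠ[𝓝 b] fun _ => 0 := by
    filter_upwards [hW.mem_nhds hbW] with z hz
    exact D.projE_of_mem_Ebar (hWB hz) (D.star_mem_Ebar (hyE z hz))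
  have h := derivDt_bilin (ContinuousLinearMap.id ℂ (HFibre g →L[ℂ] HFibre g))
    (D.differentiableAt_projDt 0 hb) hys
  rw [projDt_zero, derivDt_congr hev, derivDt_const, derivDt_star_eq_zero hy, hyb] at h
  rw [map_zero, add_zero] at h
  exact h.symm

lemma derivDt_mul {A C : ℂ → HFibre g →L[ℂ] HFibre g} {b : ℂ} (hA : DifferentiableAt ℝ A b)
    (hC : DifferentiableAt ℝ C b) :
    derivDt (fun z => A z * C z) b = derivDt A b * C b + A b * derivDt C b :=
  derivDt_bilin (ContinuousLinearMap.compL ℂ (HFibre g) (HFibre g) (HFibre g)) hA hC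

lemma projE_mul_self {b : ℂ} (hb : b ∈ B) : D.projE b * D.projE b = D.projE b := by
  ext1 v
  exact D.projE_of_mem hb (D.projE_mem b v)

/-- For `k ≥ 1`, the operator `∂ᵏP/∂tᵏ` maps `E` to its conjugate and kills the conjugate. -/
lemma projDt_mul_projE_and {k : ℕ} (hk : 1 ≤ k) : ∀ b ∈ B,
    D.projDt k b * D.projE b = D.projDt k b ∧ D.projE b * D.projDt k b = 0 := by
  have hop := D.isOpen_base
  have h1 : ∀ b ∈ B, D.projDt 1 b * D.projE b = D.projDt 1 b := fun b hb => by
    ext1 v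
    have h := D.projDt_one_of_mem_Ebar hb (D.sub_projE_mem_Ebar hb v)
    rw [map_sub, sub_eq_zero] at h
    exact h.symm
  have h1' : ∀ b ∈ B, D.projE b * D.projDt 1 b = 0 := fun b hb => by
    have h := derivDt_mul (D.differentiableAt_projDt 0 hb) (D.differentiableAt_projDt 0 hb)
    rw [projDt_zero, derivDt_congr (f' := D.projE) (by
      filter_upwards [hop.mem_nhds hb] with z hz using D.projE_mul_self hz), ← projDt_zero,
      ← projDt_succ, projDt_zero, zero_add, h1 b hb] at h
    -- `h` now reads `∂P/∂t = ∂P/∂t + P ∂P/∂t`, the derivative of `P² = P`.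
    exact left_eq_add.1 h
  induction k, hk using Nat.le_induction with
  | base => exact fun b hb => ⟨h1 b hb, h1' b hb⟩
  | succ k hk ih =>
    intro b hb
    have hA := D.differentiableAt_projDt k hb
    have hP := D.differentiableAt_projDt 0 hb
    -- Differentiate `A P = A` and `P A = 0` for `A = ∂ᵏP/∂tᵏ`; the terms `A ∂P/∂t = A P ∂P/∂t` and
    -- `∂P/∂t A = ∂P/∂t P A` vanish.
    have e1 := derivDt_mul hA hP
    have e2 := derivDt_mul hP hA
    rw [projDt_zero, ← projDt_succ, ← projDt_zero, ← projDt_succ, zero_add] at e1 e2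
    rw [derivDt_congr (f' := D.projDt k) (by
      filter_upwards [hop.mem_nhds hb] with z hz using (ih z hz).1), ← projDt_succ, projDt_zero,
      ← (ih b hb).1, mul_assoc (D.projDt k b), h1' b hb, mul_zero, add_zero] at e1
    rw [derivDt_congr (f' := fun _ => 0) (by
      filter_upwards [hop.mem_nhds hb] with z hz using (ih z hz).2), derivDt_const, projDt_zero,
      ← h1 b hb, mul_assoc (D.projDt 1 b), (ih b hb).2, mul_zero, zero_add] at e2
    exact ⟨e1.symm, e2.symm⟩

lemma projDt_projE {k : ℕ} (hk : 1 ≤ k) {b : ℂ} (hb : b ∈ B) (v : HFibre g) :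
    D.projDt k b (D.projE b v) = D.projDt k b v :=
  congrArg (fun A => A v) (D.projDt_mul_projE_and hk b hb).1

lemma projE_projDt {k : ℕ} (hk : 1 ≤ k) {b : ℂ} (hb : b ∈ B) (v : HFibre g) :
    D.projE b (D.projDt k b v) = 0 :=
  congrArg (fun A => A v) (D.projDt_mul_projE_and hk b hb).2

lemma projDt_mem_Ebar {k : ℕ} (hk : 1 ≤ k) {b : ℂ} (hb : b ∈ B) (v : HFibre g) :
    D.projDt k b v ∈ D.Ebar b := by
  have h := D.sub_projE_mem_Ebar hb (D.projDt k b v)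
  rwa [D.projE_projDt hk hb, sub_zero] at h

/-- Differentiate the constant function `Q(P u, v) + Q(u, P v) = Q(u, v)`. -/
lemma complexForm_projDt {k : ℕ} (hk : 1 ≤ k) (u v : HFibre g) : ∀ b ∈ B,
    complexForm D.Q (D.projDt k b u) v = -complexForm D.Q u (D.projDt k b v) := by
  let L : (HFibre g →L[ℂ] HFibre g) →L[ℂ] ℂ := LinearMap.toContinuousLinearMap
    { toFun := fun A => complexForm D.Q (A u) v + complexForm D.Q u (A v)
      map_add' := fun A C => by simp; ring
      map_smul' := fun a A => by simp; ring }
  suffices h : ∀ b ∈ B, L (D.projDt k b) = 0 from fun b hb => eq_neg_of_add_eq_zero_left (h b hb)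
  induction k, hk using Nat.le_induction with
  | base =>
    intro b hb
    rw [projDt_succ, ← derivDt_clm L (D.differentiableAt_projDt 0 hb), ← derivDt_const
      (complexForm D.Q u v) b]
    refine derivDt_congr ?_
    filter_upwards [D.isOpen_base.mem_nhds hb] with z hz
    exact D.complexForm_projE_add hz u v
  | succ k hk ih =>
    intro b hb
    rw [projDt_succ, ← derivDt_clm L (D.differentiableAt_projDt k hb), ← derivDt_const 0 b]
    refine derivDt_congr ?_
    filter_upwards [D.isOpen_base.mem_nhds hb] with z hz using ih z hz

/-! ### The iterated Higgs fields -/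

lemma iota2_pi2 {b : ℂ} (hb : b ∈ B) (v : HFibre g) :
    D.iota2 b (D.pi2 b v) = v - D.projE b v :=
  eq_sub_of_add_eq' (D.iota1_pi1_add_iota2_pi2 hb v)

lemma pi2_projE {b : ℂ} (hb : b ∈ B) (v : HFibre g) : D.pi2 b (D.projE b v) = 0 :=
  D.pi2_iota1 hb _

lemma eta_succ {k : ℕ} (hk : 1 ≤ k) : D.eta (k + 1) = D.nablaH (D.eta k) := by
  obtain ⟨k, rfl⟩ := Nat.exists_eq_add_of_le' hk
  exact Function.iterate_succ_apply' _ _ _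

/-- Extended by zero to the conjugate of `E`, the field `η⁽ᵏ⁾` is `∂ᵏP/∂tᵏ`. -/
lemma extendMor_eta {k : ℕ} (hk : 1 ≤ k) :
    ∀ b ∈ B, D.extendMor (D.eta k) b = D.projDt k b := by
  induction k, hk using Nat.le_induction with
  | base =>
    intro b hb
    ext1 v
    change D.iota2 b (D.pi2 b (D.projDt 1 b (D.projE b v))) = _
    rw [D.iota2_pi2 hb, D.projDt_projE le_rfl hb, D.projE_projDt le_rfl hb, sub_zero]
  | succ k hk ih =>
    intro b hb
    have hd : derivDt (D.extendMor (D.eta k)) b = D.projDt (k + 1) b := by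
      rw [projDt_succ]
      exact derivDt_congr (by filter_upwards [D.isOpen_base.mem_nhds hb] with z hz using ih z hz)
    rw [D.eta_succ hk]
    ext1 v
    change D.iota2 b (D.pi2 b (derivDt (D.extendMor (D.eta k)) b (D.projE b v)) -
      D.eta k b (D.pi1 b (D.projDt 1 b (D.projE b v)))) = _
    have h2 : D.iota2 b (D.eta k b (D.pi1 b (D.projDt 1 b (D.projE b v)))) = 0 := by
      change D.extendMor (D.eta k) b (D.projDt 1 b (D.projE b v)) = 0
      rw [ih b hb, ← D.projDt_projE hk hb, D.projE_projDt le_rfl hb, map_zero]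
    rw [map_sub, h2, hd, D.iota2_pi2 hb, D.projDt_projE (by omega) hb,
      D.projE_projDt (by omega) hb, sub_zero, sub_zero]

lemma iota2_eta {k : ℕ} (hk : 1 ≤ k) {b : ℂ} (hb : b ∈ B) (u : D.E b) :
    D.iota2 b (D.eta k b u) = D.projDt k b u := by
  rw [← D.extendMor_eta hk b hb]
  exact congrArg (fun x => D.iota2 b (D.eta k b x)) (D.pi1_iota1 hb u).symm

lemma eta_apply {k : ℕ} (hk : 1 ≤ k) {b : ℂ} (hb : b ∈ B) (u : D.E b) :
    D.eta k b u = D.pi2 b (D.projDt k b u) := by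
  rw [← D.iota2_eta hk hb, D.pi2_iota2 hb]

lemma eta_apply_eq_zero_iff {k : ℕ} (hk : 1 ≤ k) {b : ℂ} (hb : b ∈ B) (u : D.E b) :
    D.eta k b u = 0 ↔ D.projDt k b u = 0 := by
  refine ⟨fun h => ?_, fun h => ?_⟩
  · rw [← D.iota2_eta hk hb, h, map_zero]
  · rw [D.eta_apply hk hb, h, map_zero]

/-- The operator `∂ᵏP/∂tᵏ` is skew for the skew form `Q`. -/
lemma isSymmMor_eta {k : ℕ} (hk : 1 ≤ k) : D.IsSymmMor (D.eta k) := by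
  intro b hb u v
  rw [D.eta_apply hk hb, D.eta_apply hk hb, pi2_apply, pi2_apply, D.complexForm_swap v,
    D.complexForm_projDt hk _ _ b hb, neg_neg]

/-- Up to the factor `i`, the function `η⁽ᵏ⁾(α)(β)` is `Q(β, (∂ᵏP/∂tᵏ) α)`. -/
lemma isSmoothMor_eta {k : ℕ} (hk : 1 ≤ k) : D.IsSmoothMor (D.eta k) := by
  intro W _ hWB α β hα hβ
  let q : HFibre g →L[ℂ] HFibre g →L[ℂ] ℂ := LinearMap.toContinuousLinearMap
    ((LinearMap.toContinuousLinearMap : (HFibre g →ₗ[ℂ] ℂ) ≃ₗ[ℂ] _).toLinearMap ∘ₗ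
      complexForm D.Q)
  have h : ContDiffOn ℝ ∞ (fun b => D.projDt k b (α b)) W :=
    ContDiffOn.bilin (ContinuousLinearMap.id ℂ (HFibre g →L[ℂ] HFibre g))
      ((D.contDiffOn_projDt k).mono hWB) hα
  have h2 := (ContDiffOn.bilin q hβ h).const_smul Complex.I
  refine h2.congr fun b hb => ?_
  rw [D.eta_apply hk (hWB hb), pi2_apply]
  rfl

/-- Differentiate `α = P α`. -/
lemma derivDt_section {W : Set ℂ} (hW : IsOpen W) (hWB : W ⊆ B) {α : D.SecE}
    (hα : D.IsSmoothSection W α) {b : ℂ} (hb : b ∈ W) :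
    derivDt (fun z => (α z : HFibre g)) b = D.projDt 1 b (α b) +
      D.projE b (derivDt (fun z => (α z : HFibre g)) b) := by
  have h := derivDt_bilin (ContinuousLinearMap.id ℂ (HFibre g →L[ℂ] HFibre g))
    (D.differentiableAt_projDt 0 (hWB hb)) ((hα.contDiffAt (hW.mem_nhds hb)).differentiableAt
      (by simp))
  refine Eq.trans (derivDt_congr ?_) h
  filter_upwards [hW.mem_nhds hb] with z hz
  exact (D.projE_of_mem (hWB hz) (α z).2).symm

lemma isContractedHiggs_eta_one : D.IsContractedHiggs (D.eta 1) := by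
  intro W hW hWB α hα b hb
  have h : contrDt (D.higgs α b) = D.pi2 b (derivDt (fun z => (α z : HFibre g)) b) := by
    simp only [derivDt_apply, map_smul, map_sub]
    rfl
  rw [h, D.derivDt_section hW hWB hα hb, map_add, D.eta_apply le_rfl (hWB hb),
    D.pi2_projE (hWB hb), add_zero]

lemma isNablaH_eta {k : ℕ} (hk : 1 ≤ k) : D.IsNablaH (D.eta k) (D.eta (k + 1)) := by
  intro W hW hWB α hα b hb
  have hbB := hWB hb
  have h1 : derivDt (fun z => D.iota2 z (D.eta k z (α z))) b =
      D.projDt (k + 1) b (α b) + D.projDt k b (derivDt (fun z => (α z : HFibre g)) b) := by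
    rw [projDt_succ]
    have h := derivDt_bilin (ContinuousLinearMap.id ℂ (HFibre g →L[ℂ] HFibre g))
      (D.differentiableAt_projDt k hbB) ((hα.contDiffAt (hW.mem_nhds hb)).differentiableAt
        (by simp))
    refine Eq.trans (derivDt_congr ?_) h
    filter_upwards [hW.mem_nhds hb] with z hz
    exact D.iota2_eta hk (hWB hz) (α z)
  have h2 : D.eta k b (D.nablaE α b) =
      D.pi2 b (D.projDt k b (derivDt (fun z => (α z : HFibre g)) b)) := by
    rw [D.eta_apply hk hbB, ← D.projDt_projE hk hbB (derivDt _ b)]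
    rfl
  have h3 : D.nablaEdual (fun z => D.eta k z (α z)) b =
      D.pi2 b (derivDt (fun z => D.iota2 z (D.eta k z (α z))) b) := rfl
  rw [h2, h3, h1, map_add, add_sub_cancel_right, D.eta_apply (by omega) hbB]

/-- The kernels of `η⁽¹⁾, …, η⁽ʳ⁾` in `E_b` are cut out by the holomorphic conditions
`Q(u, eᵢ⁽ⁿ⁾(b)) = 0`, `n ≤ r`, for a holomorphic frame `e` of `E`: expand `eᵢ⁽ⁿ⁾ = (P eᵢ)⁽ⁿ⁾` by the
Leibniz rule. -/
lemma projDt_eq_zero_iff {W : Set ℂ} (hW : IsOpen W) (hWB : W ⊆ B) {e : Fin g → ℂ → HFibre g}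
    (he : ∀ i, DifferentiableOn ℂ (e i) W)
    (hfr : ∀ z ∈ W, Submodule.span ℂ (Set.range fun i => e i z) = D.E z) {b : ℂ} (hb : b ∈ W)
    {u : HFibre g} (hu : u ∈ D.E b) (r : ℕ) :
    (∀ k, 1 ≤ k → k ≤ r → D.projDt k b u = 0) ↔
      ∀ n ≤ r, ∀ i, complexForm D.Q u (deriv^[n] (e i) b) = 0 := by
  have hbB := hWB hb
  have hmem : ∀ z ∈ W, ∀ i, e i z ∈ D.E z := fun z hz i =>
    hfr z hz ▸ Submodule.subset_span (Set.mem_range_self i)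
  have hexp : ∀ i n, complexForm D.Q u (deriv^[n] (e i) b) =
      ∑ kj ∈ Finset.HasAntidiagonal.antidiagonal n,
        n.choose kj.1 • complexForm D.Q u (D.projDt kj.1 b (deriv^[kj.2] (e i) b)) := by
    intro i n
    have h := iterate_derivDt_bilin (ContinuousLinearMap.id ℂ (HFibre g →L[ℂ] HFibre g)) hW
      (D.contDiffOn_projE.mono hWB) (((he i).contDiffOn hW).restrict_scalars ℝ) n b hb
    rw [iterate_derivDt_congr hW (f := fun z => ContinuousLinearMap.id ℂ (HFibre g →L[ℂ] HFibre g)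
      (D.projE z) (e i z)) (f' := e i) (fun z hz => D.projE_of_mem (hWB hz) (hmem z hz i))
      n hb, iterate_derivDt_eq_iterate_deriv hW (he i) n hb] at h
    rw [h, map_sum]
    refine Finset.sum_congr rfl fun kj _ => ?_
    rw [map_nsmul, iterate_derivDt_eq_iterate_deriv hW (he i) kj.2 hb]
    rfl
  -- For `k = 0` because `E` is isotropic, for `k ≥ 1` because `∂ᵏP/∂tᵏ` is skew for `Q`.
  have hterm : ∀ k, (1 ≤ k → D.projDt k b u = 0) → ∀ v, complexForm D.Q u (D.projDt k b v) = 0 := by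
    intro k hk v
    rcases Nat.eq_zero_or_pos k with rfl | h0
    · exact D.isotropic b hbB u hu _ (D.projE_mem b v)
    · rw [← neg_eq_zero, ← D.complexForm_projDt h0 u v b hbB, hk h0, map_zero, LinearMap.zero_apply]
  refine ⟨fun h n hn i => ?_, fun h k => ?_⟩
  · rw [hexp]
    refine Finset.sum_eq_zero fun kj hkj => ?_
    have := Finset.HasAntidiagonal.mem_antidiagonal.1 hkj
    rw [hterm kj.1 (fun h1 => h kj.1 h1 (by omega)), smul_zero]
  · induction k using Nat.strong_induction_on with
    | _ k ih =>
      intro hk hkr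
      -- By induction, only the term `Q(u, (∂ᵏP/∂tᵏ) eᵢ)` of the expansion of `Q(u, eᵢ⁽ᵏ⁾)` remains.
      refine D.eq_zero_of_mem_Ebar hbB (D.projDt_mem_Ebar hk hbB u) fun v hv => ?_
      have hi : ∀ i, complexForm D.Q (D.projDt k b u) (e i b) = 0 := fun i => by
        have h1 := h k hkr i
        rw [hexp, Finset.sum_eq_single_of_mem (k, 0)
          (by simp)] at h1
        · rw [D.complexForm_projDt hk _ _ b hbB, neg_eq_zero]
          simpa using h1
        · intro kj hkj hne
          have h2 := Finset.HasAntidiagonal.mem_antidiagonal.1 hkj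
          have h3 : kj.1 ≠ k := fun h3 => hne (Prod.ext h3 (by simp; omega))
          rw [hterm kj.1 (fun h4 => ih kj.1 (by omega) h4 (by omega)), smul_zero]
      rw [← hfr b hb] at hv
      have hle : Submodule.span ℂ (Set.range fun i => e i b) ≤
          LinearMap.ker (complexForm D.Q (D.projDt k b u)) :=
        Submodule.span_le.2 (Set.range_subset_iff.2 hi)
      exact hle hv

end PVHS

/-! ### Meromorphic germs and generic linear relations -/

/-- The ring of germs at the punctured point `p` of functions meromorphic at `p`. -/
def meromorphicGerms (p : ℂ) : Subring (Germ (𝓝[≠] p) ℂ) where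
  carrier := {x | ∃ f : ℂ → ℂ, MeromorphicAt f p ∧ (f : Germ (𝓝[≠] p) ℂ) = x}
  mul_mem' := by
    rintro _ _ ⟨f, hf, rfl⟩ ⟨h, hh, rfl⟩
    exact ⟨f * h, hf.mul hh, rfl⟩
  one_mem' := ⟨1, MeromorphicAt.const 1 p, rfl⟩
  add_mem' := by
    rintro _ _ ⟨f, hf, rfl⟩ ⟨h, hh, rfl⟩
    exact ⟨f + h, hf.add hh, rfl⟩
  zero_mem' := ⟨0, MeromorphicAt.const 0 p, rfl⟩
  neg_mem' := by
    rintro _ ⟨f, hf, rfl⟩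
    exact ⟨-f, hf.neg, rfl⟩

/-- A meromorphic germ is either zero or nowhere zero on a punctured neighbourhood. -/
lemma isField_meromorphicGerms (p : ℂ) : IsField (meromorphicGerms p) where
  exists_pair_ne := ⟨0, 1, zero_ne_one⟩
  mul_comm := mul_comm
  mul_inv_cancel := by
    rintro ⟨_, f, hf, rfl⟩ h0
    refine ⟨⟨_, f⁻¹, hf.inv, rfl⟩, Subtype.ext (Germ.coe_eq.2 ?_)⟩
    rcases hf.eventually_eq_zero_or_eventually_ne_zero with h | h
    · exact absurd (Subtype.ext (Germ.coe_eq.2 h)) h0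
    · filter_upwards [h] with z hz using mul_inv_cancel₀ hz

instance (p : ℂ) : Field (meromorphicGerms p) := (isField_meromorphicGerms p).toField

/-- The element of the field of meromorphic germs defined by a function meromorphic at `p`. -/
def MeromorphicAt.toGerm {p : ℂ} {f : ℂ → ℂ} (hf : MeromorphicAt f p) : meromorphicGerms p :=
  ⟨f, f, hf, rfl⟩

lemma sum_mul_toGerm_eq_iff {p : ℂ} {ι : Type*} [Fintype ι] {c f : ι → ℂ → ℂ} {h : ℂ → ℂ}
    (hc : ∀ k, MeromorphicAt (c k) p) (hf : ∀ k, MeromorphicAt (f k) p) (hh : MeromorphicAt h p) :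
    ∑ k, (hc k).toGerm * (hf k).toGerm = hh.toGerm ↔
      (fun z => ∑ k, c k z * f k z) =ᶠ[𝓝[≠] p] h := by
  rw [← Germ.coe_eq, Subtype.ext_iff]
  have h1 : (fun z => ∑ k, c k z * f k z) = ∑ k, c k * f k := by
    ext z
    simp
  have h2 : ((∑ k, c k * f k : ℂ → ℂ) : Germ (𝓝[≠] p) ℂ) =
      ∑ k, (c k : Germ (𝓝[≠] p) ℂ) * (f k : Germ (𝓝[≠] p) ℂ) :=
    map_sum (Germ.coeRingHom (𝓝[≠] p)) (fun k => c k * f k) Finset.univ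
  rw [h1, h2, AddSubmonoidClass.coe_finsetSum]
  rfl

/-- In a finite dimensional space the increasing sequence of the spans of the `x i j`, `j ≤ m`,
cannot grow at each of the steps `m = 0, …, r`, since it starts in dimension `card ι`. -/
lemma exists_le_forall_mem_span {K M ι : Type*} [Field K] [AddCommGroup M] [Module K M]
    [Module.Finite K M] [Fintype ι] (x : ι → ℕ → M) (h0 : LinearIndependent K fun i => x i 0)
    {r : ℕ} (hr : Module.finrank K M ≤ Fintype.card ι + r) :
    ∃ m ≤ r, ∀ i, x i (m + 1) ∈
      Submodule.span K (Set.range fun k : ι × Fin (m + 1) => x k.1 k.2) := by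
  by_contra! hcon
  let S : ℕ → Submodule K M := fun m =>
    Submodule.span K (Set.range fun k : ι × Fin (m + 1) => x k.1 k.2)
  have hle : ∀ m, S m ≤ S (m + 1) := fun m => Submodule.span_mono (by
    rintro _ ⟨k, rfl⟩
    exact ⟨(k.1, k.2.castSucc), rfl⟩)
  have hdim : ∀ m ≤ r + 1, Fintype.card ι + m ≤ Module.finrank K (S m) := by
    intro m
    induction m with
    | zero =>
      intro _
      rw [add_zero, ← finrank_span_eq_card h0]
      refine Submodule.finrank_mono (Submodule.span_mono ?_)
      rintro _ ⟨i, rfl⟩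
      exact ⟨(i, 0), rfl⟩
    | succ m ih =>
      intro hm
      obtain ⟨i, hi⟩ := hcon m (by omega)
      have hlt : S m < S (m + 1) := lt_of_le_of_ne (hle m) fun h => hi (by
        change _ ∈ S m
        rw [h]
        exact Submodule.subset_span ⟨(i, Fin.last (m + 1)), rfl⟩)
      have := Submodule.finrank_lt_finrank_of_lt hlt
      have := ih (by omega)
      omega
  have h1 := hdim (r + 1) le_rfl
  have h2 := Submodule.finrank_le (S (r + 1))
  omega

/-- For a holomorphic frame of rank `g` in `ℂᴺ` and `r ≥ N - g`, there is an order `m ≤ r` such that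
the derivatives of order `m + 1` are combinations of those of order at most `m`, with coefficients
meromorphic at `p`. -/
lemma exists_meromorphic_relation {g N r : ℕ} (hr : N ≤ g + r) {p : ℂ} {e : Fin g → ℂ → Fin N → ℂ}
    (he : ∀ i, AnalyticAt ℂ (e i) p)
    (hli : ∀ᶠ z in 𝓝[≠] p, LinearIndependent ℂ fun i => e i z) :
    ∃ m ≤ r, ∀ i, ∃ c : Fin g × Fin (m + 1) → ℂ → ℂ, (∀ k, MeromorphicAt (c k) p) ∧
      ∀ᶠ z in 𝓝[≠] p, deriv^[m + 1] (e i) z = ∑ k, c k z • deriv^[k.2] (e k.1) z := by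
  have han : ∀ i n a, MeromorphicAt (fun z => deriv^[n] (e i) z a) p := fun i n a =>
    (((ContinuousLinearMap.proj (R := ℂ) (φ := fun _ : Fin N => ℂ) a).analyticAt _).comp
      ((he i).iterated_deriv n)).meromorphicAt
  let x : Fin g → ℕ → Fin N → meromorphicGerms p := fun i n a => (han i n a).toGerm
  have h0 : LinearIndependent (meromorphicGerms p) fun i => x i 0 := by
    rw [Fintype.linearIndependent_iff]
    intro c hc
    choose f hf hfc using fun i => (c i).2
    have hcf : ∀ i, c i = (hf i).toGerm := fun i => Subtype.ext (hfc i).symm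
    have h1 : ∀ a, (fun z => ∑ i, f i z * e i z a) =ᶠ[𝓝[≠] p] fun _ => 0 := fun a => by
      refine (sum_mul_toGerm_eq_iff hf (fun i => han i 0 a) (MeromorphicAt.const 0 p)).1 ?_
      have h2 := congrFun hc a
      simp only [Finset.sum_apply, Pi.smul_apply, smul_eq_mul, hcf] at h2
      exact h2
    intro i
    rw [hcf]
    refine Subtype.ext (Germ.coe_eq.2 ?_)
    filter_upwards [hli, eventually_all.2 h1] with z hz hz1
    refine Fintype.linearIndependent_iff.1 hz (fun i => f i z) ?_ i
    ext a
    simpa using hz1 a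
  obtain ⟨m, hm, h⟩ := exists_le_forall_mem_span x h0 (r := r) (by simpa using hr)
  refine ⟨m, hm, fun i => ?_⟩
  obtain ⟨c, hc⟩ := (Submodule.mem_span_range_iff_exists_fun _).1 (h i)
  choose f hf hfc using fun k => (c k).2
  have hcf : ∀ k, c k = (hf k).toGerm := fun k => Subtype.ext (hfc k).symm
  refine ⟨f, hf, ?_⟩
  have h1 : ∀ a, (fun z => ∑ k : Fin g × Fin (m + 1), f k z * deriv^[k.2] (e k.1) z a)
      =ᶠ[𝓝[≠] p] fun z => deriv^[m + 1] (e i) z a := fun a => by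
    rw [← sum_mul_toGerm_eq_iff hf (fun k => han k.1 k.2 a) (han i (m + 1) a)]
    have h2 := congrFun hc a
    simp only [Finset.sum_apply, Pi.smul_apply, smul_eq_mul, hcf] at h2
    exact h2
  filter_upwards [eventually_all.2 h1] with z hz
  ext a
  simpa using (hz a).symm

/-- If the derivatives of finitely many holomorphic functions are combinations of these functions
with holomorphic coefficients, then so are all derivatives of such combinations. -/
lemma exists_iterate_deriv_eq_sum {N : ℕ} {ι : Type*} [Fintype ι] {U : Set ℂ} (hU : IsOpen U)
    {b : ι → ℂ → Fin N → ℂ} (hb : ∀ k, DifferentiableOn ℂ (b k) U) {d : ι → ι → ℂ → ℂ}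
    (hd : ∀ k l, DifferentiableOn ℂ (d k l) U)
    (hbd : ∀ k, ∀ z ∈ U, deriv (b k) z = ∑ l, d k l z • b l z) {v : ℂ → Fin N → ℂ}
    {c : ι → ℂ → ℂ} (hc : ∀ k, DifferentiableOn ℂ (c k) U)
    (hv : ∀ z ∈ U, v z = ∑ k, c k z • b k z) (n : ℕ) :
    ∃ c' : ι → ℂ → ℂ, (∀ k, DifferentiableOn ℂ (c' k) U) ∧
      ∀ z ∈ U, deriv^[n] v z = ∑ k, c' k z • b k z := by
  induction n with
  | zero => exact ⟨c, hc, hv⟩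
  | succ n ih =>
    obtain ⟨a, ha, hva⟩ := ih
    refine ⟨fun l z => deriv (a l) z + ∑ k, a k z * d k l z, fun l => ?_, fun z hz => ?_⟩
    · exact ((ha l).deriv hU).add (DifferentiableOn.fun_sum fun k _ => (ha k).mul (hd k l))
    · have had : ∀ k, DifferentiableAt ℂ (a k) z := fun k =>
        (ha k).differentiableAt (hU.mem_nhds hz)
      have hbz : ∀ k, DifferentiableAt ℂ (b k) z := fun k =>
        (hb k).differentiableAt (hU.mem_nhds hz)
      rw [Function.iterate_succ_apply',
        (Set.EqOn.eventuallyEq_of_mem (s := U) hva (hU.mem_nhds hz)).deriv_eq,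
        deriv_fun_sum fun k _ => (had k).fun_smul (hbz k)]
      simp_rw [deriv_fun_smul (had _) (hbz _), hbd _ z hz, add_smul, Finset.sum_smul,
        Finset.smul_sum, smul_smul, Finset.sum_add_distrib]
      rw [add_comm, Finset.sum_comm]

/-- Near `p`, except possibly at `p` itself, all derivatives of a frame of rank `g` in `ℂᴺ` are
combinations of those of order at most `r`, for any `r ≥ N - g`. -/
lemma eventually_iterate_deriv_mem_span {g N r : ℕ} (hr : N ≤ g + r) {p : ℂ}
    {e : Fin g → ℂ → Fin N → ℂ} (he : ∀ i, AnalyticAt ℂ (e i) p)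
    (hli : ∀ᶠ z in 𝓝[≠] p, LinearIndependent ℂ fun i => e i z) :
    ∀ᶠ z in 𝓝[≠] p, ∀ i n, deriv^[n] (e i) z ∈
      Submodule.span ℂ (Set.range fun k : Fin g × Fin (r + 1) => deriv^[k.2] (e k.1) z) := by
  obtain ⟨m, hm, h⟩ := exists_meromorphic_relation hr he hli
  choose c hc hrel using h
  have hev : ∀ᶠ z in 𝓝[≠] p, (∀ i, AnalyticAt ℂ (e i) z) ∧ (∀ i k, AnalyticAt ℂ (c i k) z) ∧
      ∀ i, deriv^[m + 1] (e i) z = ∑ k, c i k z • deriv^[k.2] (e k.1) z := by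
    filter_upwards [eventually_all.2 fun i => (he i).eventually_analyticAt.filter_mono
      nhdsWithin_le_nhds, eventually_all.2 fun i => eventually_all.2 fun k =>
      (hc i k).eventually_analyticAt, eventually_all.2 hrel] with z h1 h2 h3 using ⟨h1, h2, h3⟩
  obtain ⟨O, hO, hpO, hOs⟩ := mem_nhdsWithin.1 hev
  have hU : IsOpen (O ∩ {p}ᶜ) := hO.inter isOpen_compl_singleton
  let b : Fin g × Fin (m + 1) → ℂ → Fin N → ℂ := fun k => deriv^[k.2] (e k.1)
  have hb : ∀ k, DifferentiableOn ℂ (b k) (O ∩ {p}ᶜ) := fun k z hz =>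
    (((hOs hz).1 k.1).iterated_deriv k.2).differentiableAt.differentiableWithinAt
  -- The derivative of `b (i, j)` is `b (i, j + 1)` for `j < m`, and for `j = m` it is given by the
  -- relation with coefficients `c i`.
  let d : Fin g × Fin (m + 1) → Fin g × Fin (m + 1) → ℂ → ℂ := fun k l =>
    if (k.2 : ℕ) = m then c k.1 l else fun _ => if l.1 = k.1 ∧ (l.2 : ℕ) = k.2 + 1 then 1 else 0
  have hd : ∀ k l, DifferentiableOn ℂ (d k l) (O ∩ {p}ᶜ) := fun k l => by
    simp only [d]
    split_ifs with h1
    · exact fun z hz => ((hOs hz).2.1 k.1 l).differentiableAt.differentiableWithinAt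
    · exact differentiableOn_const _
    · exact differentiableOn_const _
  have hbd : ∀ k, ∀ z ∈ O ∩ {p}ᶜ, deriv (b k) z = ∑ l, d k l z • b l z := by
    intro k z hz
    have hs : deriv (b k) z = deriv^[k.2 + 1] (e k.1) z := by
      rw [Function.iterate_succ_apply']
    rw [hs]
    by_cases hk : (k.2 : ℕ) = m
    · simp only [d, hk, if_true]
      exact (hOs hz).2.2 k.1
    · have hlt : (k.2 : ℕ) + 1 < m + 1 := by omega
      rw [Finset.sum_eq_single (k.1, ⟨k.2 + 1, hlt⟩)]
      · simp [d, hk, b]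
      · intro l _ hl
        have h3 : ¬(l.1 = k.1 ∧ (l.2 : ℕ) = k.2 + 1) := fun h3 =>
          hl (Prod.ext h3.1 (Fin.ext h3.2))
        simp [d, hk, h3]
      · simp
  filter_upwards [inter_mem (mem_nhdsWithin_of_mem_nhds (hO.mem_nhds hpO)) self_mem_nhdsWithin]
    with z hz i n
  obtain ⟨c', -, hc'⟩ := exists_iterate_deriv_eq_sum hU hb hd hbd (v := e i)
    (c := fun k _ => if k = (i, 0) then 1 else 0) (fun k => differentiableOn_const _)
    (fun w _ => by simp [b]) n
  rw [hc' z hz]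
  refine Submodule.sum_mem _ fun k _ => Submodule.smul_mem _ _ (Submodule.subset_span ?_)
  exact ⟨(k.1, k.2.castLE (by omega)), rfl⟩

/-! ### The flat unitary part -/

lemma AnalyticAt.eventually_eq_zero_of_iterate_deriv {f : ℂ → ℂ} {z : ℂ} (hf : AnalyticAt ℂ f z)
    (h : ∀ n, deriv^[n] f z = 0) : ∀ᶠ w in 𝓝 z, f w = 0 := by
  rw [← analyticOrderAt_eq_top, ENat.eq_top_iff_forall_ge]
  intro m
  rw [natCast_le_analyticOrderAt_iff_iteratedDeriv_eq_zero hf]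
  intro i _
  rw [iteratedDeriv_eq_iterate, h]

lemma iterate_deriv_clm {F : Type*} [NormedAddCommGroup F] [NormedSpace ℂ F] [CompleteSpace F]
    (L : F →L[ℂ] ℂ) {f : ℂ → F} {z : ℂ} (hf : AnalyticAt ℂ f z) (n : ℕ) :
    deriv^[n] (fun w => L (f w)) z = L (deriv^[n] f z) := by
  have h : ∀ n, ∀ᶠ w in 𝓝 z, deriv^[n] (fun w => L (f w)) w = L (deriv^[n] f w) := fun n => by
    induction n with
    | zero => exact .of_forall fun _ => rfl
    | succ n ih =>
      filter_upwards [ih.eventually_nhds, hf.eventually_analyticAt] with w hw hfw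
      rw [Function.iterate_succ_apply', Function.iterate_succ_apply', EventuallyEq.deriv_eq hw]
      exact (L.hasFDerivAt.comp_hasDerivAt w
        (hfw.iterated_deriv n).differentiableAt.hasDerivAt).deriv
  exact (h n).self_of_nhds

namespace PVHS

variable {g : ℕ} {B : Set ℂ} (D : PVHS g B)

/-- The space of vectors of `V_ℂ` that lie in `E_z` for all `z ∈ B`, i.e. of the values of global
flat sections of `E`. -/
def flatPart : Submodule ℂ (HFibre g) := ⨅ z ∈ B, D.E z

lemma mem_flatPart {v : HFibre g} : v ∈ D.flatPart ↔ ∀ z ∈ B, v ∈ D.E z := by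
  simp [flatPart, Submodule.mem_iInf]

/-- The linear functional `Q(v, ·)`. -/
def formL (v : HFibre g) : HFibre g →L[ℂ] ℂ := LinearMap.toContinuousLinearMap (complexForm D.Q v)

lemma mem_E_iff_frame {b : ℂ} (hb : b ∈ B) {e : Fin g → HFibre g}
    (he : Submodule.span ℂ (Set.range e) = D.E b) {v : HFibre g} :
    v ∈ D.E b ↔ ∀ i, complexForm D.Q v (e i) = 0 := by
  rw [D.mem_E_iff hb, ← he]
  refine ⟨fun h i => h _ (Submodule.subset_span (Set.mem_range_self i)), fun h u hu => ?_⟩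
  have hle : Submodule.span ℂ (Set.range e) ≤ LinearMap.ker (complexForm D.Q v) :=
    Submodule.span_le.2 (Set.range_subset_iff.2 h)
  exact hle hu

/-- The identity theorem for the condition `v ∈ E_z`. -/
lemma eventually_mem_E_of_frequently {p : ℂ} (hp : p ∈ B) {v : HFibre g}
    (h : ∃ᶠ z in 𝓝[≠] p, v ∈ D.E z) : ∀ᶠ z in 𝓝 p, v ∈ D.E z := by
  obtain ⟨W, hW, hpW, hWB, e, he, hfr⟩ := D.local_frame p hp
  have hz : ∀ i, ∀ᶠ z in 𝓝 p, D.formL v (e i z) = 0 := fun i => by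
    have han : AnalyticAt ℂ (fun z => D.formL v (e i z)) p :=
      ((D.formL v).analyticAt _).comp ((he i).analyticAt (hW.mem_nhds hpW))
    refine han.frequently_zero_iff_eventually_zero.1 ?_
    refine (h.and_eventually (mem_nhdsWithin_of_mem_nhds (hW.mem_nhds hpW))).mono ?_
    rintro z ⟨hv, hz⟩
    exact (D.mem_E_iff_frame (hWB hz) (hfr z hz).2).1 hv i
  filter_upwards [eventually_all.2 hz, hW.mem_nhds hpW] with z h1 h2
  exact (D.mem_E_iff_frame (hWB h2) (hfr z h2).2).2 h1

/-- A vector lying in `E_z` for all `z` near one point of a connected base lies in all fibres. -/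
lemma mem_flatPart_of_eventually (hB : IsPreconnected B) {p : ℂ} (hp : p ∈ B) {v : HFibre g}
    (h : ∀ᶠ z in 𝓝 p, v ∈ D.E z) : v ∈ D.flatPart := by
  have hsub : B ⊆ {b | ∀ᶠ z in 𝓝 b, v ∈ D.E z} := by
    refine hB.subset_of_closure_inter_subset isOpen_setOfPred_eventually_nhds ⟨p, hp, h⟩ ?_
    rintro b ⟨hb, hbB⟩
    by_cases hbU : ∀ᶠ z in 𝓝 b, v ∈ D.E z
    · exact hbU
    · refine D.eventually_mem_E_of_frequently hbB ?_
      rw [mem_closure_iff_frequently] at hb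
      rw [frequently_nhdsWithin_iff]
      refine hb.mono fun z hz => ⟨hz.self_of_nhds, ?_⟩
      rintro rfl
      exact hbU hz
  exact D.mem_flatPart.2 fun z hz => (hsub hz).self_of_nhds

lemma flat_section_mem_flatPart (hB : IsPreconnected B) {W : Set ℂ} (hW : IsOpen W) {b : ℂ}
    (hb : b ∈ W) (hbB : b ∈ B) {σ : D.SecE} (hσ : D.IsFlatSection W σ) :
    (σ b : HFibre g) ∈ D.flatPart := by
  obtain ⟨ε, hε, hball⟩ := Metric.isOpen_iff.1 hW b hb
  have hconst : ∀ z ∈ Metric.ball b ε, (σ z : HFibre g) = σ b := fun z hz => by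
    refine Metric.isOpen_ball.is_const_of_fderiv_eq_zero (𝕜 := ℝ)
      (convex_ball b ε).isPreconnected
      (fun w hw => ((hσ.1.differentiableAt (hW.mem_nhds (hball hw))).restrictScalars
        ℝ).differentiableWithinAt) (fun w hw => ?_) hz (Metric.mem_ball_self hε)
    have h := hσ.2 w (hball hw)
    ext1 x
    exact congrArg (fun φ => φ x) h
  refine D.mem_flatPart_of_eventually hB hbB ?_
  filter_upwards [Metric.ball_mem_nhds b hε] with z hz
  rw [← hconst z hz]
  exact (σ z).2

lemma mem_flatPart_of_isSectionU (hB : IsPreconnected B) {W : Set ℂ} {α : D.SecE}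
    (hα : D.IsSectionU W α) {b : ℂ} (hb : b ∈ W) (hbB : b ∈ B) :
    (α b : HFibre g) ∈ D.flatPart := by
  obtain ⟨W', hW', hbW', -, n, σ, f, hσ, -, h⟩ := hα b hb
  rw [h b hbW', Submodule.coe_sum]
  exact Submodule.sum_mem _ fun i _ =>
    Submodule.smul_mem _ _ (D.flat_section_mem_flatPart hB hW' hbW' hbB (hσ i))

lemma isHolSection_of_isSectionU {W : Set ℂ} {α : D.SecE} (hα : D.IsSectionU W α) :
    D.IsHolSection W α := by
  intro p hp
  obtain ⟨W', hW', hpW', hWW, n, σ, f, hσ, hf, h⟩ := hα p hp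
  have hd : DifferentiableAt ℂ (fun z => ∑ i, f i z • (σ i z : HFibre g)) p :=
    DifferentiableAt.fun_sum fun i _ => ((hf i).differentiableAt (hW'.mem_nhds hpW')).fun_smul
      ((hσ i).1.differentiableAt (hW'.mem_nhds hpW'))
  refine (hd.congr_of_eventuallyEq ?_).differentiableWithinAt
  filter_upwards [hW'.mem_nhds hpW'] with z hz
  simp [h z hz]

open Classical in
/-- The constant section with value `v`; it is set to `0` at the points `z` where `v` is not in
`E_z`. -/
def constSection (v : HFibre g) : D.SecE := fun z => if h : v ∈ D.E z then ⟨v, h⟩ else 0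

lemma constSection_coe {v : HFibre g} (hv : v ∈ D.flatPart) {z : ℂ} (hz : z ∈ B) :
    (D.constSection v z : HFibre g) = v := by
  rw [constSection, dif_pos (D.mem_flatPart.1 hv z hz)]

lemma isFlatSection_constSection {v : HFibre g} (hv : v ∈ D.flatPart) {W : Set ℂ}
    (hW : IsOpen W) (hWB : W ⊆ B) : D.IsFlatSection W (D.constSection v) := by
  have h : Set.EqOn (fun z => D.iota1 z (D.constSection v z)) (fun _ => v) W :=
    fun z hz => D.constSection_coe hv (hWB hz)
  refine ⟨(differentiableOn_const v).congr h, fun b hb => ?_⟩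
  rw [gaussManin, (h.eventuallyEq_of_mem (hW.mem_nhds hb)).fderiv_eq, fderiv_fun_const]
  rfl

/-- Expand in a basis of the flat part. -/
lemma isSectionU_of_mem_flatPart {W : Set ℂ} (hW : IsOpen W) (hWB : W ⊆ B) {α : D.SecE}
    (hα : D.IsHolSection W α) (h : ∀ b ∈ W, (α b : HFibre g) ∈ D.flatPart) :
    D.IsSectionU W α := by
  intro p hp
  let bas := Module.finBasis ℂ D.flatPart
  obtain ⟨q, hq⟩ := D.flatPart.exists_isCompl
  let π := D.flatPart.projectionOnto q hq
  refine ⟨W, hW, hp, subset_rfl, _, fun i => D.constSection (bas i : HFibre g),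
    fun i z => bas.coord i (π (α z)), fun i => D.isFlatSection_constSection (bas i).2 hW hWB,
    fun i => ?_, fun z hz => ?_⟩
  · exact (LinearMap.toContinuousLinearMap
      (bas.coord i ∘ₗ π)).differentiable.comp_differentiableOn hα
  · have h1 : π (α z) = ⟨α z, h z hz⟩ :=
      Submodule.projectionOnto_apply_left hq ⟨α z, h z hz⟩
    have h2 := congrArg Subtype.val (bas.sum_repr ⟨α z, h z hz⟩)
    ext1
    rw [Submodule.coe_sum] at h2 ⊢
    rw [← h2]
    refine Finset.sum_congr rfl fun i _ => ?_
    simp [h1, D.constSection_coe (bas i).2 (hWB hz)]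

/-- The fibres of the flat unitary subbundle are all equal to the flat part. -/
lemma mem_fibreU_iff (hB : IsPreconnected B) {b : ℂ} (hb : b ∈ B) (u : D.E b) :
    u ∈ D.fibreU b ↔ (u : HFibre g) ∈ D.flatPart := by
  constructor
  · rintro ⟨W, -, hbW, α, hα, rfl⟩
    exact D.mem_flatPart_of_isSectionU hB hα hbW hb
  · intro hu
    refine ⟨B, D.isOpen_base, hb, D.constSection u, ?_, Subtype.ext (D.constSection_coe hu hb)⟩
    refine D.isSectionU_of_mem_flatPart D.isOpen_base subset_rfl
      (D.isFlatSection_constSection hu D.isOpen_base subset_rfl).1 fun z hz => ?_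
    rwa [D.constSection_coe hu hz]

/-- Differentiate the constant function `P v = v`. -/
lemma projDt_of_mem_flatPart {k : ℕ} (hk : 1 ≤ k) {b : ℂ} (hb : b ∈ B) {v : HFibre g}
    (hv : v ∈ D.flatPart) : D.projDt k b v = 0 := by
  have h : ∀ k, 1 ≤ k → ∀ b ∈ B, D.projDt k b v = 0 := fun k hk => by
    let L : (HFibre g →L[ℂ] HFibre g) →L[ℂ] HFibre g := ContinuousLinearMap.apply ℂ _ v
    induction k, hk using Nat.le_induction with
    | base =>
      intro b hb
      change L (D.projDt 1 b) = 0
      rw [projDt_succ, ← derivDt_clm L (D.differentiableAt_projDt 0 hb), ← derivDt_const v b]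
      refine derivDt_congr ?_
      filter_upwards [D.isOpen_base.mem_nhds hb] with z hz
      exact D.projE_of_mem hz (D.mem_flatPart.1 hv z hz)
    | succ k hk ih =>
      intro b hb
      change L (D.projDt (k + 1) b) = 0
      rw [projDt_succ, ← derivDt_clm L (D.differentiableAt_projDt k hb), ← derivDt_const 0 b]
      refine derivDt_congr ?_
      filter_upwards [D.isOpen_base.mem_nhds hb] with z hz using ih z hz
  exact h k hk b hb

/-- Near every point `p` of the base, except possibly at `p`, the common kernel of
`η⁽¹⁾, …, η⁽ᵍ⁾` is the flat part. -/
lemma eventually_mem_flatPart (hB : IsPreconnected B) {p : ℂ} (hp : p ∈ B) :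
    ∀ᶠ z in 𝓝[≠] p, ∀ u ∈ D.E z, (∀ k, 1 ≤ k → k ≤ g → D.projDt k z u = 0) → u ∈ D.flatPart := by
  obtain ⟨W, hW, hpW, hWB, e, he, hfr⟩ := D.local_frame p hp
  have hnhds : ∀ᶠ z in 𝓝[≠] p, z ∈ W := mem_nhdsWithin_of_mem_nhds (hW.mem_nhds hpW)
  have hspan := eventually_iterate_deriv_mem_span (r := g) (by omega)
    (fun i => (he i).analyticAt (hW.mem_nhds hpW)) (hnhds.mono fun z hz => (hfr z hz).1)
  filter_upwards [hspan, hnhds] with z hz hzW u hu hk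
  have h0 := (D.projDt_eq_zero_iff hW hWB he (fun z hz => (hfr z hz).2) hzW hu g).1 hk
  have hall : ∀ i n, D.formL u (deriv^[n] (e i) z) = 0 := fun i n => by
    have hle : Submodule.span ℂ (Set.range fun k : Fin g × Fin (g + 1) => deriv^[k.2] (e k.1) z) ≤
        LinearMap.ker (complexForm D.Q u) :=
      Submodule.span_le.2 (Set.range_subset_iff.2 fun k => h0 k.2 (by omega) k.1)
    exact hle (hz i n)
  have hev : ∀ i, ∀ᶠ w in 𝓝 z, D.formL u (e i w) = 0 := fun i => by
    have han : AnalyticAt ℂ (e i) z := (he i).analyticAt (hW.mem_nhds hzW)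
    refine AnalyticAt.eventually_eq_zero_of_iterate_deriv (((D.formL u).analyticAt _).comp han)
      fun n => ?_
    exact (iterate_deriv_clm (D.formL u) han n).trans (hall i n)
  refine D.mem_flatPart_of_eventually hB (hWB hzW) ?_
  filter_upwards [eventually_all.2 hev, hW.mem_nhds hzW] with w hw hwW
  exact (D.mem_E_iff_frame (hWB hwW) (hfr w hwW).2).2 hw

/-- The sections of the flat unitary subbundle are the holomorphic sections killed by
`η⁽¹⁾, …, η⁽ᵍ⁾`: such a section has values in the flat part near each point `p`, except possibly
at `p`, and the flat part is closed. -/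
lemma isSectionU_iff (hB : IsPreconnected B) {W : Set ℂ} (hW : IsOpen W) (hWB : W ⊆ B)
    {α : D.SecE} (hα : D.IsHolSection W α) :
    D.IsSectionU W α ↔ ∀ k, 1 ≤ k → k ≤ g → ∀ b ∈ W, D.eta k b (α b) = 0 := by
  refine ⟨fun h k hk _ b hb => ?_, fun h => ?_⟩
  · rw [D.eta_apply_eq_zero_iff hk (hWB hb)]
    exact D.projDt_of_mem_flatPart hk (hWB hb) (D.mem_flatPart_of_isSectionU hB h hb (hWB hb))
  · refine D.isSectionU_of_mem_flatPart hW hWB hα fun p hp => ?_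
    have hcont : Tendsto (fun z => (α z : HFibre g)) (𝓝[≠] p) (𝓝 (α p)) :=
      (hα.differentiableAt (hW.mem_nhds hp)).continuousAt.tendsto.mono_left nhdsWithin_le_nhds
    refine D.flatPart.closed_of_finiteDimensional.mem_of_tendsto hcont ?_
    filter_upwards [D.eventually_mem_flatPart hB (hWB hp),
      mem_nhdsWithin_of_mem_nhds (hW.mem_nhds hp)] with z hz hzW
    exact hz _ (α z).2 fun k hk hkg =>
      (D.eta_apply_eq_zero_iff hk (hWB hzW) _).1 (h k hk hkg z hzW)

lemma mem_iInf_ker_eta {b : ℂ} (hb : b ∈ B) (u : D.E b) :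
    u ∈ ⨅ k ∈ Finset.Icc 1 g, LinearMap.ker (D.eta k b) ↔
      ∀ k, 1 ≤ k → k ≤ g → D.projDt k b u = 0 := by
  simp only [Submodule.mem_iInf, Finset.mem_Icc, LinearMap.mem_ker, and_imp]
  exact forall_congr' fun k => forall_congr' fun hk => forall_congr' fun _ =>
    D.eta_apply_eq_zero_iff hk hb u

lemma fibreU_le (hB : IsPreconnected B) {b : ℂ} (hb : b ∈ B) :
    D.fibreU b ≤ ⨅ k ∈ Finset.Icc 1 g, LinearMap.ker (D.eta k b) := fun u hu =>
  (D.mem_iInf_ker_eta hb u).2 fun _ hk _ =>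
    D.projDt_of_mem_flatPart hk hb ((D.mem_fibreU_iff hB hb u).1 hu)

end PVHS

/-! ### The theorem -/

/-- A subset of an open set whose complement has no accumulation point there is dense and
Zariski-open. -/
lemma isDenseZariskiOpen_of_eventually {B G : Set ℂ} (hB : IsOpen B) (hGB : G ⊆ B)
    (h : ∀ p ∈ B, ∀ᶠ z in 𝓝[≠] p, z ∈ G) : IsDenseZariskiOpen B G := by
  refine ⟨hGB, ⟨Set.sdiff_subset, fun p hp => ?_⟩, fun p hp => ?_⟩
  · obtain ⟨O, hO, hpO, hOG⟩ := mem_nhdsWithin.1 (h p hp)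
    by_cases hpG : p ∈ G
    · refine ⟨O ∩ B, hO.inter hB, ⟨hpO, hp⟩, Set.inter_subset_right, 1, fun _ _ => 1,
        fun _ => differentiableOn_const _, fun z hz => ?_⟩
      have hzG : z ∈ G := by
        by_cases hzp : z = p
        · rwa [hzp]
        · exact hOG ⟨hz.1, hzp⟩
      simp [hzG]
    · refine ⟨O ∩ B, hO.inter hB, ⟨hpO, hp⟩, Set.inter_subset_right, 1, fun _ z => z - p,
        fun _ => differentiableOn_id.sub_const p, fun z hz => ?_⟩
      rw [forall_const, sub_eq_zero]
      refine ⟨fun hzG => ?_, fun hzp => ?_⟩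
      · by_contra hzp
        exact hzG.2 (hOG ⟨hz.1, hzp⟩)
      · rw [hzp]
        exact ⟨hp, hpG⟩
  · rw [mem_closure_iff_frequently]
    exact ((h p hp).frequently).filter_mono nhdsWithin_le_nhds

end

theorem theorem2p5 (g : ℕ) (c : ℂ) (r : ℝ) (hr : 0 < r) (D : PVHS g (Metric.ball c r)) :
    (D.IsContractedHiggs (D.eta 1) ∧ ∀ k, 1 ≤ k → D.IsNablaH (D.eta k) (D.eta (k + 1))) ∧
    (∀ k, 1 ≤ k → D.IsSmoothMor (D.eta k) ∧ D.IsSymmMor (D.eta k)) ∧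
    (∀ W : Set ℂ, IsOpen W → W ⊆ Metric.ball c r →
      (∀ α : D.SecE, D.IsHolSection W α →
        (D.IsSectionU W α ↔ ∀ k, 1 ≤ k → k ≤ g → ∀ b ∈ W, D.eta k b (α b) = 0)) ∧
      {α : D.SecE | D.IsSectionU W α} = {α : D.SecE | D.IsSectionK g W α}) ∧
    (∀ b ∈ Metric.ball c r, D.fibreU b ≤ ⨅ k ∈ Finset.Icc 1 g, LinearMap.ker (D.eta k b)) ∧
    ∃ G : Set ℂ, IsDenseZariskiOpen (Metric.ball c r) G ∧
      ∀ b ∈ G, D.fibreU b = ⨅ k ∈ Finset.Icc 1 g, LinearMap.ker (D.eta k b) := by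
  have hB : IsPreconnected (Metric.ball c r) := (convex_ball c r).isPreconnected
  refine ⟨⟨D.isContractedHiggs_eta_one, fun k hk => D.isNablaH_eta hk⟩,
    fun k hk => ⟨D.isSmoothMor_eta hk, D.isSymmMor_eta hk⟩, fun W hW hWB =>
      ⟨fun α hα => D.isSectionU_iff hB hW hWB hα, ?_⟩, fun b hb => D.fibreU_le hB hb,
    {b ∈ Metric.ball c r | D.fibreU b = ⨅ k ∈ Finset.Icc 1 g, LinearMap.ker (D.eta k b)},
    isDenseZariskiOpen_of_eventually Metric.isOpen_ball (fun b hb => hb.1) fun p hp => ?_,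
    fun b hb => hb.2⟩
  · ext α
    refine ⟨fun h => ?_, fun h => (D.isSectionU_iff hB hW hWB h.1).2 h.2⟩
    have hα := D.isHolSection_of_isSectionU h
    exact ⟨hα, (D.isSectionU_iff hB hW hWB hα).1 h⟩
  · filter_upwards [D.eventually_mem_flatPart hB hp,
      mem_nhdsWithin_of_mem_nhds (Metric.isOpen_ball.mem_nhds hp)] with z hz hzB
    refine ⟨hzB, le_antisymm (D.fibreU_le hB hzB) fun u hu => ?_⟩
    exact (D.mem_fibreU_iff hB hzB u).2 (hz u u.2 ((D.mem_iInf_ker_eta hzB u).1 hu))
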